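/- **Setting.** Let $S,T$ be Bernoulli variables with joint probabilities $p_{ij}=P(S=i,T=j)$, $i,j\in\{0,1\}$, and put $q_1=p_{00}+p_{01}$, $q_2=p_{00}+p_{10}$ (the parameters of a bivariate Marshall–Olkin geometric distribution). Assume $p_{00},q_1,q_2\in(0,1)$ and $p_{00}\ge q_1q_2$. Let $n\ge 1$ be an integer and let $\gamma,\delta>0$. On $[-\log n,\infty)^2$ define $$\lambda^\star(s,t)=\begin{cases}\dfrac{\log(p_{00}/q_2)\log q_2}{\log^2(1/p_{00})}\,e^{-\frac{\log(p_{00}/q_2)}{\log p_{00}}s}\,e^{-\frac{\log q_2}{\log p_{00}}t}, & s<t,\\[2mm] \dfrac{\log(p_{00}/q_1)\log q_1}{\log^2(1/p_{00})}\,e^{-\frac{\log q_1}{\log p_{00}}s}\,e^{-\frac{\log(p_{00}/q_1)}{\log p_{00}}t}, & s>t,\end{cases}\qquad \acute\lambda^\star(s)=\frac{\log(p_{00}/(q_1q_2))}{\log(1/p_{00})}\,e^{-s},$$ $$\lambda^\star_{\gamma,\delta}(s,t)=\begin{cases}\dfrac{\gamma(1+\delta)}{(1+\gamma+\delta)^2}\,e^{-\frac{\gamma}{1+\gamma+\delta}s}\,e^{-\frac{1+\delta}{1+\gamma+\delta}t},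 & s<t,\\[2mm] \dfrac{\delta(1+\gamma)}{(1+\gamma+\delta)^2}\,e^{-\frac{1+\gamma}{1+\gamma+\delta}s}\,e^{-\frac{\delta}{1+\gamma+\delta}t}, & s>t,\end{cases}\qquad \acute\lambda^\star_{\gamma,\delta}(s)=\frac{1}{1+\gamma+\delta}\,e^{-s}.$$ For a Borel set $A^\star\subseteq[-\log n,\infty)^2$ let $$\boldsymbol\lambda^\star(B)=\iint_{A^\star\cap B}\lambda^\star(s,t)\,ds\,dt+\int_{\{s:\,(s,s)\in A^\star\cap B\}}\acute\lambda^\star(s)\,ds$$ for Borel $B\subseteq[-\log n,\infty)^2$, and let $\boldsymbol\lambda^\star_{\gamma,\delta}$ be defined in the same way from $\lambda^\star_{\gamma,\delta}$ and $\acute\lambda^\star_{\gamma,\delta}$. For a finite measure $\boldsymbol\lambda$, $\mathrm{PRM}(\boldsymbol\lambda)$ denotes the law of the Poisson process with mean measure $\boldsymbol\lambda$, a probability measure on the space $M_p$ of finite point measures on $[-\log n,\infty)^2$. **Distances.** $d_{TV}(\mu,\nu)=\sup_R|\mu(R)-\nu(R)|$ over measurable $R$. Let $d_0(z,w)=\min(1,|z-w|)$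 with $|\cdot|$ the Euclidean norm. For $\xi_1,\xi_2\in M_p$ let $d_1(\xi_1,\xi_2)=1$ if the numbers of points differ, $d_1(\xi_1,\xi_2)=0$ if both are zero, and otherwise, with $m$ the common number of points, $d_1(\xi_1,\xi_2)=\frac1m\sup_\kappa|\int\kappa\,d\xi_1-\int\kappa\,d\xi_2|$ over all real functions $\kappa$ that are $1$-Lipschitz with respect to $d_0$. For probability measures $\mu,\nu$ on $M_p$ let $d_2(\mu,\nu)=\sup_h|\int h\,d\mu-\int h\,d\nu|$ over all $h:M_p\to\mathbb R$ that are $1$-Lipschitz with respect to $d_1$. Write $|\boldsymbol\lambda^\star-\boldsymbol\lambda^\star_{\gamma,\delta}|$ for the variation measure of the signed measure $\boldsymbol\lambda^\star-\boldsymbol\lambda^\star_{\gamma,\delta}$, and $0^{-1/2}=\infty$. **Theorem.** (1) For every Borel set $A^\star\subseteq[-\log n,\infty)^2$, $$d_{TV}\big(\mathrm{PRM}(\boldsymbol\lambda^\star),\mathrm{PRM}(\boldsymbol\lambda^\star_{\gamma,\delta})\big)\le\int_{A^\star}|\boldsymbol\lambda^\star(dz)-\boldsymbol\lambda^\star_{\gamma,\delta}(dz)|,$$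 $$d_2\big(\mathrm{PRM}(\boldsymbol\lambda^\star),\mathrm{PRM}(\boldsymbol\lambda^\star_{\gamma,\delta})\big)\le\Big(1\wedge1.65\min\{\boldsymbol\lambda^\star(A^\star)^{-1/2},\boldsymbol\lambda^\star_{\gamma,\delta}(A^\star)^{-1/2}\}\Big)\int_{A^\star}|\boldsymbol\lambda^\star(dz)-\boldsymbol\lambda^\star_{\gamma,\delta}(dz)|.$$ (2) Suppose in addition that $p_{10}=\gamma p_{11}$ and $p_{01}=\delta p_{11}$ (so $q_1=1-(1+\gamma)p_{11}$, $q_2=1-(1+\delta)p_{11}$, $p_{00}=1-(1+\gamma+\delta)p_{11}$), and let $A^\star=[u^\star,\infty)^2$ with $u^\star\ge-\log n$. Then the two right-hand sides in (1) are at most, respectively, $$\frac{4(1+\gamma+\delta)^2p_{11}}{[1-(1+\gamma+\delta)p_{11}]^3}\,e^{-u^\star}\qquad\text{and}\qquad\big(e^{-u^\star}\wedge1.65\,e^{-u^\star/2}\big)\frac{4(1+\gamma+\delta)^2p_{11}}{[1-(1+\gamma+\delta)p_{11}]^3},$$ and hence these also bound $d_{TV}\big(\mathrm{PRM}(\boldsymbol\lambda^\star),\mathrm{PRM}(\boldsymbol\lambda^\star_{\gamma,\delta})\big)$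 and $d_2\big(\mathrm{PRM}(\boldsymbol\lambda^\star),\mathrm{PRM}(\boldsymbol\lambda^\star_{\gamma,\delta})\big)$, respectively. -/

import Mathlib

open MeasureTheory ProbabilityTheory
open scoped ENNReal NNReal

noncomputable section

/-! ### Point measures, Poisson random measures and distances between their laws -/

/-- Finite point measures on `E`: finite sums of Dirac measures at not necessarily distinct points.
As a subtype of `Measure E` it carries the smallest σ-algebra that makes all evaluation maps
`ξ ↦ ξ B`, for `B` measurable, measurable. -/
abbrev PointMeasure (E : Type*) [MeasurableSpace E] : Type _ :=
  {ξ : Measure E // ∃ (m : ℕ) (z : Fin m → E), ξ = ∑ i, Measure.dirac (z i)}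

/-- `P` is the law of a Poisson process with mean measure `Λ`. -/
structure IsPRM {E : Type*} [MeasurableSpace E] (Λ : Measure E)
    (P : Measure (PointMeasure E)) : Prop where
  isProbabilityMeasure : IsProbabilityMeasure P
  count : ∀ B : Set E, MeasurableSet B → ∀ k : ℕ,
    P {ξ | ξ.1 B = k} = if Λ B = ⊤ then 0 else poissonMeasure (Λ B).toNNReal {k}
  indep : ∀ (m : ℕ) (B : Fin m → Set E), (∀ i, MeasurableSet (B i)) →
    Pairwise (fun i j => Disjoint (B i) (B j)) →
    iIndepFun (fun (i : Fin m) (ξ : PointMeasure E) => ξ.1 (B i)) P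

/-- Total variation distance between probability measures, `sup_B |μ(B) - ν(B)|`. -/
def dTV {X : Type*} [MeasurableSpace X] (μ ν : Measure X) : ℝ≥0∞ :=
  ⨆ (B : Set X) (_ : MeasurableSet B), ENNReal.ofReal |μ.real B - ν.real B|

/-- The distance `d₁` between finite measures that is induced by a metric `d₀ ≤ 1` on `E`:
it is `1` if the total masses differ, and otherwise the Wasserstein distance of the normalised
measures. The supremum over all Lipschitz functions `κ`, divided by the Lipschitz constant, is
written as the supremum over those `κ` with Lipschitz constant at most `1`.
Two zero measures have distance `0`. -/
def d1 {E : Type*} [MeasurableSpace E] (d₀ : E → E → ℝ) (ρ σ : Measure E) : ℝ :=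
  open Classical in
  if ρ Set.univ ≠ σ Set.univ then 1
  else (ρ.real Set.univ)⁻¹ *
    ⨆ κ : {κ : E → ℝ // ∀ x y, |κ x - κ y| ≤ d₀ x y}, |∫ x, κ.1 x ∂ρ - ∫ x, κ.1 x ∂σ|

/-- The distance `d₂` between probability measures on the space of finite point measures, i.e. the
Wasserstein distance induced by `d₁`. -/
def d2 {E : Type*} [MeasurableSpace E] (d₀ : E → E → ℝ)
    (μ ν : Measure (PointMeasure E)) : ℝ≥0∞ :=
  ⨆ (h : PointMeasure E → ℝ) (_ : Measurable h)
    (_ : ∀ ξ₁ ξ₂ : PointMeasure E, |h ξ₁ - h ξ₂| ≤ d1 d₀ ξ₁.1 ξ₂.1),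
    ENNReal.ofReal |∫ ξ, h ξ ∂μ - ∫ ξ, h ξ ∂ν|

/-- The variation measure `|μ - ν|` of the difference of two finite measures: the sum of the positive
part `μ - ν` and the negative part `ν - μ` of its Jordan decomposition (the subtraction of measures
is truncated at `0`). -/
def absDiff {E : Type*} [MeasurableSpace E] (μ ν : Measure E) : Measure E :=
  (μ - ν) + (ν - μ)

/-! ### The Marshall–Olkin geometric setting -/

/-- The joint distribution `pᵢⱼ = P(S = i, T = j)` of two Bernoulli random variables. -/
structure BernoulliPair where
  p00 : ℝ
  p01 : ℝ
  p10 : ℝ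
  p11 : ℝ
  p00_nonneg : 0 ≤ p00
  p01_nonneg : 0 ≤ p01
  p10_nonneg : 0 ≤ p10
  p11_nonneg : 0 ≤ p11
  sum_eq_one : p00 + p01 + p10 + p11 = 1

namespace BernoulliPair

/-- The failure probability `q₁ = P(S = 0)`. -/
def q1 (p : BernoulliPair) : ℝ := p.p00 + p.p01

/-- The failure probability `q₂ = P(T = 0)`. -/
def q2 (p : BernoulliPair) : ℝ := p.p00 + p.p10

/-- The intensity `λ*(s,t)` off the diagonal (with value `0` on the diagonal, a null set). -/
def intensity (p : BernoulliPair) (s t : ℝ) : ℝ :=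
  if s < t then
    Real.log (p.p00 / p.q2) * Real.log p.q2 / Real.log (1 / p.p00) ^ 2 *
      Real.exp (-(Real.log (p.p00 / p.q2) / Real.log p.p00) * s) *
      Real.exp (-(Real.log p.q2 / Real.log p.p00) * t)
  else if t < s then
    Real.log (p.p00 / p.q1) * Real.log p.q1 / Real.log (1 / p.p00) ^ 2 *
      Real.exp (-(Real.log p.q1 / Real.log p.p00) * s) *
      Real.exp (-(Real.log (p.p00 / p.q1) / Real.log p.p00) * t)
  else 0

/-- The intensity `λ́*(s)` on the diagonal. -/
def diagIntensity (p : BernoulliPair) (s : ℝ) : ℝ :=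
  Real.log (p.p00 / (p.q1 * p.q2)) / Real.log (1 / p.p00) * Real.exp (-s)

end BernoulliPair

/-- The intensity `λ*_{γ,δ}(s,t)` off the diagonal (with value `0` on the diagonal). -/
def limitIntensity (γ δ s t : ℝ) : ℝ :=
  if s < t then
    γ * (1 + δ) / (1 + γ + δ) ^ 2 *
      Real.exp (-(γ / (1 + γ + δ)) * s) * Real.exp (-((1 + δ) / (1 + γ + δ)) * t)
  else if t < s then
    δ * (1 + γ) / (1 + γ + δ) ^ 2 *
      Real.exp (-((1 + γ) / (1 + γ + δ)) * s) * Real.exp (-(δ / (1 + γ + δ)) * t)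
  else 0

/-- The intensity `λ́*_{γ,δ}(s)` on the diagonal. -/
def limitDiagIntensity (γ δ s : ℝ) : ℝ := 1 / (1 + γ + δ) * Real.exp (-s)

/-- The state space `[-log n, ∞)²`. -/
abbrev StateSpace (n : ℕ) : Type :=
  {z : ℝ × ℝ // -Real.log n ≤ z.1 ∧ -Real.log n ≤ z.2}

/-- The Euclidean distance on the state space, bounded by `1`. -/
def d0 {n : ℕ} (z w : StateSpace n) : ℝ :=
  min 1 (Real.sqrt ((z.1.1 - w.1.1) ^ 2 + (z.1.2 - w.1.2) ^ 2))

/-- The measure `B ↦ ∫∫_{A ∩ B} f(s,t) ds dt + ∫_{A ∩ B ∩ {s = t}} g(s) ds` on `[-log n, ∞)²`,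
where the diagonal is parametrised by `s ↦ (s, s)`. -/
def intensityMeasure {n : ℕ} (f : ℝ → ℝ → ℝ) (g : ℝ → ℝ) (A : Set (StateSpace n)) :
    Measure (StateSpace n) :=
  (Measure.comap (Subtype.val : StateSpace n → ℝ × ℝ)
    ((volume : Measure (ℝ × ℝ)).withDensity (fun z => ENNReal.ofReal (f z.1 z.2)) +
      Measure.map (fun s : ℝ => (s, s))
        ((volume : Measure ℝ).withDensity (fun s => ENNReal.ofReal (g s))))).restrict A

/-- The mean measure `λ*` on `A`. -/
def meanMeasure {n : ℕ} (p : BernoulliPair) (A : Set (StateSpace n)) : Measure (StateSpace n) :=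
  intensityMeasure p.intensity p.diagIntensity A

/-- The mean measure `λ*_{γ,δ}` on `A`. -/
def limitMeasure {n : ℕ} (γ δ : ℝ) (A : Set (StateSpace n)) : Measure (StateSpace n) :=
  intensityMeasure (limitIntensity γ δ) (limitDiagIntensity γ δ) A

/-- The set `[u, ∞)²` of joint exceedances of the threshold `u`. -/
def jointExceedance (n : ℕ) (u : ℝ) : Set (StateSpace n) := {z | u ≤ z.1.1 ∧ u ≤ z.1.2}

/-- The factor `1 ∧ 1.65 min(x^{-1/2}, y^{-1/2})`, where `0^{-1/2} = ∞`. -/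
def steinFactor (x y : ℝ≥0∞) : ℝ≥0∞ :=
  min 1 (ENNReal.ofReal 1.65 * min (x ^ (-(1 / 2) : ℝ)) (y ^ (-(1 / 2) : ℝ)))

end

/-! Everything reduces to comparing two finite mean measures `Λ`, `Λ'` through their common part `c
= min(Λ, Λ')`; no Stein equation is solved. Write `V` for the total mass of `|Λ - Λ'|`.

The characteristic functional determines the law of a Poisson process (`IsPRM.eq_poissonLaw`), so
both laws may be taken to be the explicit mixture `poissonLaw` of the images of `Λ^{⊗k}` with
weights `exp(-Λ(E))/k!`.

Total variation: `poissonLaw Λ` dominates `exp(-(Λ - c)(E)) • poissonLaw c`. Hence both laws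
dominate `exp(-V) • poissonLaw c`, and they differ by at most `1 - exp(-V) ≤ V`.

Distance `d2`: let `M ≥ m` be the total masses of `Λ` and `Λ'`. Given `k` points, the normalised
measures are coupled coordinatewise, at a cost of at most `(Λ - Λ')(E)/M`. Changing the law of the
count costs at most `√M - √m ≤ V/√M`, by a Hellinger estimate. When `√M ≥ 1.65` the sum is at most
`1.65 V/√M`; otherwise the Stein factor for `M` is `1` and the previous bound suffices.

Part (2): with `a = log q1 / log p00` and `b = log q2 / log p00`, both intensities belong to one
family `moIntensity`, the limit having `α = (1+γ)/(1+γ+δ)` and `β = (1+δ)/(1+γ+δ)`. Every member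
gives `[u,∞)²` the mass `exp(-u)`, so the positive and negative parts of the difference have equal
mass and a one-sided domination is enough. With `x = 1 - p00`, `log_ratio_bounds` gives `(1-x)α ≤ a
≤ α` and likewise for `b`, `β`; hence the limit measure exceeds the other by at most `2x exp(-u)`,
and the variation is at most `4x exp(-u)`, which is below the stated bound. -/

noncomputable section

/-! ### The Poisson law as a mixture of product measures -/

section PoissonLaw

variable {E : Type*} [MeasurableSpace E]

/-- The point measure `∑ᵢ δ_{zᵢ}`. -/
def PointMeasure.ofFun {k : ℕ} (z : Fin k → E) : PointMeasure E :=
  ⟨∑ i, Measure.dirac (z i), k, z, rfl⟩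

theorem PointMeasure.exists_eq_ofFun (ξ : PointMeasure E) :
    ∃ (k : ℕ) (z : Fin k → E), ξ = PointMeasure.ofFun z := by
  obtain ⟨ξ, k, z, rfl⟩ := ξ
  exact ⟨k, z, rfl⟩

theorem PointMeasure.ofFun_apply {k : ℕ} (z : Fin k → E) {B : Set E} (hB : MeasurableSet B) :
    (PointMeasure.ofFun z).1 B = ∑ i, B.indicator 1 (z i) := by
  simp [PointMeasure.ofFun, Measure.dirac_apply' _ hB]

theorem PointMeasure.ofFun_univ {k : ℕ} (z : Fin k → E) :
    (PointMeasure.ofFun z).1 Set.univ = k := by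
  simp [PointMeasure.ofFun_apply z MeasurableSet.univ]

instance (ξ : PointMeasure E) : IsFiniteMeasure ξ.1 := by
  obtain ⟨k, z, rfl⟩ := ξ.exists_eq_ofFun
  exact ⟨by rw [PointMeasure.ofFun_univ]; exact ENNReal.natCast_lt_top k⟩

theorem PointMeasure.measurable_apply {B : Set E} (hB : MeasurableSet B) :
    Measurable fun ξ : PointMeasure E => ξ.1 B :=
  (Measure.measurable_coe hB).comp measurable_subtype_coe

theorem PointMeasure.measurable_ofFun (k : ℕ) :
    Measurable (PointMeasure.ofFun : (Fin k → E) → PointMeasure E) := by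
  refine Measurable.subtype_mk (Measure.measurable_of_measurable_coe _ fun B hB => ?_)
  change Measurable fun z : Fin k → E => (PointMeasure.ofFun z).1 B
  simp_rw [PointMeasure.ofFun_apply _ hB]
  exact Finset.measurable_fun_sum _ fun i _ =>
    (measurable_one.indicator hB).comp (measurable_pi_apply i)

theorem PointMeasure.integral_ofFun {k : ℕ} (z : Fin k → E) {f : E → ℝ}
    (hf : Measurable f) : ∫ x, f x ∂(PointMeasure.ofFun z).1 = ∑ i, f (z i) := by
  simp only [PointMeasure.ofFun]
  rw [integral_finsetSum_measure]
  · exact Finset.sum_congr rfl fun i _ => integral_dirac' _ _ hf.stronglyMeasurable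
  · exact fun i _ => ⟨hf.aestronglyMeasurable, by
      simp [HasFiniteIntegral, lintegral_dirac' _ hf.enorm]⟩

/-- The law of the Poisson process with mean measure `Λ`, as a mixture over the number of
points. -/
def poissonLaw (Λ : Measure E) : Measure (PointMeasure E) :=
  Measure.sum fun k : ℕ => ENNReal.ofReal (Real.exp (-Λ.real Set.univ) / k.factorial) •
    (Measure.pi fun _ : Fin k => Λ).map PointMeasure.ofFun

/-- The complex argument is needed for characteristic functionals, where `c = ∫ exp(i f) dΛ`. -/
theorem hasSum_exp_neg_mul_pow (r : ℝ) (c : ℂ) :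
    HasSum (fun k : ℕ => ((Real.exp (-r) / k.factorial : ℝ) : ℂ) * c ^ k)
      (Complex.exp (c - r)) := by
  have h := (NormedSpace.expSeries_div_hasSum_exp c).mul_left (Real.exp (-r) : ℂ)
  rw [← Complex.exp_eq_exp_ℂ, Complex.ofReal_exp, ← Complex.exp_add] at h
  have e : ((-r : ℝ) : ℂ) + c = c - r := by push_cast; ring
  rw [e] at h
  refine h.congr_fun fun k => ?_
  push_cast
  ring

theorem hasSum_poisson (r : ℝ) :
    HasSum (fun k : ℕ => Real.exp (-r) / k.factorial * r ^ k) 1 := by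
  have h := (NormedSpace.expSeries_div_hasSum_exp r).mul_left (Real.exp (-r))
  rw [← Real.exp_eq_exp_ℝ, ← Real.exp_add, neg_add_cancel, Real.exp_zero] at h
  exact h.congr_fun fun k => by ring

variable (Λ : Measure E)

instance isProbabilityMeasure_poissonLaw [IsFiniteMeasure Λ] : IsProbabilityMeasure (poissonLaw Λ) := by
  refine ⟨?_⟩
  have h := hasSum_poisson (Λ.real Set.univ)
  rw [poissonLaw, Measure.sum_apply _ MeasurableSet.univ, ← ENNReal.ofReal_one, ← h.tsum_eq,
    ENNReal.ofReal_tsum_of_nonneg (fun k => by positivity) h.summable]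
  refine tsum_congr fun k => ?_
  rw [Measure.smul_apply, Measure.map_apply (PointMeasure.measurable_ofFun k) MeasurableSet.univ,
    Set.preimage_univ, Measure.pi_univ, ENNReal.ofReal_mul (by positivity)]
  simp [ENNReal.ofReal_pow]

theorem hasSum_integral_poissonLaw {F : Type*} [NormedAddCommGroup F] [NormedSpace ℝ F]
    [CompleteSpace F] {h : PointMeasure E → F} (hh : Integrable h (poissonLaw Λ)) :
    HasSum (fun k : ℕ => (Real.exp (-Λ.real Set.univ) / k.factorial) •
      ∫ z, h (PointMeasure.ofFun z) ∂(Measure.pi fun _ : Fin k => Λ))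
      (∫ ξ, h ξ ∂(poissonLaw Λ)) := by
  have := hasSum_integral_measure hh
  refine this.congr_fun fun k => ?_
  rw [integral_smul_measure, ENNReal.toReal_ofReal (by positivity), integral_map]
  · exact (PointMeasure.measurable_ofFun k).aemeasurable
  · have h1 := hh.aestronglyMeasurable.mono_measure (Measure.le_sum _ k)
    -- The weight of the `k`-th component is positive, so removing it creates no new null sets to
    -- worry about.
    refine h1.mono_ac (Measure.AbsolutelyContinuous.mk fun s _ hs => ?_)
    have : ENNReal.ofReal (Real.exp (-Λ.real Set.univ) / k.factorial) ≠ 0 := by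
      simp only [ne_eq, ENNReal.ofReal_eq_zero, not_le]; positivity
    simpa [this] using hs

end PoissonLaw

/-! ### Uniqueness of the law of a Poisson process -/

section Uniqueness

variable {E : Type*} [MeasurableSpace E]

theorem MeasureTheory.SimpleFunc.finsetSum_apply {ι : Type*} (s : Finset ι)
    (f : ι → SimpleFunc E ℝ) (x : E) : (∑ i ∈ s, f i) x = ∑ i ∈ s, f i x := by
  classical
  induction s using Finset.induction_on with
  | empty => simp
  | insert i s hi ih => rw [Finset.sum_insert hi, Finset.sum_insert hi, SimpleFunc.add_apply, ih]

theorem PointMeasure.measurable_integral_simpleFunc (f : SimpleFunc E ℝ) :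
    Measurable fun ξ : PointMeasure E => ∫ x, f x ∂ξ.1 := by
  have h : (fun ξ : PointMeasure E => ∫ x, f x ∂ξ.1) =
      fun ξ => ∑ y ∈ f.range, (ξ.1 (f ⁻¹' {y})).toReal * y := by
    ext ξ
    rw [← SimpleFunc.integral_eq_integral f (SimpleFunc.integrable_of_isFiniteMeasure f),
      SimpleFunc.integral_eq]
    rfl
  rw [h]
  exact Finset.measurable_fun_sum _ fun y _ =>
    (PointMeasure.measurable_apply (f.measurableSet_fiber y)).ennreal_toReal.mul_const y

/-- The characteristic functional of `poissonLaw Λ`. -/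
theorem integral_cexp_poissonLaw (Λ : Measure E) [IsFiniteMeasure Λ] (f : SimpleFunc E ℝ) :
    ∫ ξ, Complex.exp ((∫ x, f x ∂ξ.1 : ℝ) * Complex.I) ∂(poissonLaw Λ) =
      Complex.exp (∫ x, (Complex.exp (f x * Complex.I) - 1) ∂Λ) := by
  have hint : Integrable
      (fun ξ : PointMeasure E => Complex.exp ((∫ x, f x ∂ξ.1 : ℝ) * Complex.I))
      (poissonLaw Λ) := by
    refine Integrable.of_bound (C := 1) ?_ (ae_of_all _ fun ξ => ?_)
    · have := PointMeasure.measurable_integral_simpleFunc f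
      exact (by fun_prop : Measurable _).aestronglyMeasurable
    · rw [Complex.norm_exp_ofReal_mul_I]
  have hf : Integrable (fun x => Complex.exp (f x * Complex.I)) Λ := by
    refine Integrable.of_bound (C := 1) ?_ (ae_of_all _ fun ξ => ?_)
    · have := f.measurable
      exact (by fun_prop : Measurable _).aestronglyMeasurable
    · rw [Complex.norm_exp_ofReal_mul_I]
  -- Given `k` points the exponential factorises over them, so the `k`-th term is `exp(-Λ(E)) c^k /
  -- k!` with `c = ∫ exp(i f) dΛ`.
  refine (hasSum_integral_poissonLaw Λ hint).unique ?_
  rw [integral_sub hf (integrable_const _), integral_const]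
  simp only [mul_one, Complex.real_smul]
  refine (hasSum_exp_neg_mul_pow _ _).congr_fun fun k => ?_
  congr 1
  simp_rw [PointMeasure.integral_ofFun _ f.measurable, Complex.ofReal_sum, Finset.sum_mul,
    Complex.exp_sum]
  rw [integral_fintype_prod_eq_pow (fun x => Complex.exp (f x * Complex.I)), Fintype.card_fin]

theorem IsPRM.integral_comp_count {Λ : Measure E} [IsFiniteMeasure Λ]
    {P : Measure (PointMeasure E)} (hP : IsPRM Λ P) {B : Set E} (hB : MeasurableSet B) (y : ℝ) :
    ∫ ξ, Complex.exp (((ξ.1 B).toReal * y : ℝ) * Complex.I) ∂P =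
      Complex.exp (Λ.real B * (Complex.exp (y * Complex.I) - 1)) := by
  have hP1 := hP.isProbabilityMeasure
  -- Point measures take values in `ℕ`, so rounding loses nothing, and the count becomes a variable
  -- whose law on `ℕ` is `poissonMeasure`.
  let N : PointMeasure E → ℕ := fun ξ => ⌊(ξ.1 B).toReal⌋₊
  have hN : Measurable N :=
    Nat.measurable_floor.comp (PointMeasure.measurable_apply hB).ennreal_toReal
  have hNB : ∀ ξ : PointMeasure E, ξ.1 B = N ξ := by
    classical
    intro ξ
    obtain ⟨k, z, rfl⟩ := ξ.exists_eq_ofFun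
    have h : (PointMeasure.ofFun z).1 B = ((Finset.univ.filter fun i => z i ∈ B).card : ℕ) := by
      rw [PointMeasure.ofFun_apply z hB]
      simp [Set.indicator_apply]
    simp [N, h]
  have hlaw : P.map N = poissonMeasure (Λ.real B).toNNReal := by
    refine Measure.ext_of_singleton fun k => ?_
    rw [Measure.map_apply hN (measurableSet_singleton k)]
    have := hP.count B hB k
    rw [if_neg (measure_ne_top Λ B)] at this
    have e : (Λ.real B).toNNReal = (Λ B).toNNReal := by
      rw [measureReal_def]; exact Real.toNNReal_coe
    rw [e, ← this]
    congr 1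
    ext ξ
    simp [hNB]
  have key := charFun_map_cast_poissonMeasure (Λ.real B).toNNReal y
  rw [← hlaw, Measure.map_map (by fun_prop) hN, charFun_apply,
    integral_map (by fun_prop) (by fun_prop)] at key
  rw [Real.coe_toNNReal _ measureReal_nonneg] at key
  rw [← key]
  refine integral_congr_ae (ae_of_all _ fun ξ => ?_)
  simp [hNB, mul_comm]

/-- The integral of `f` is a linear combination of the counts of its level sets. These are disjoint,
so independence turns the expectation into a product of Poisson characteristic functions. -/
theorem IsPRM.integral_cexp {Λ : Measure E} [IsFiniteMeasure Λ]
    {P : Measure (PointMeasure E)} (hP : IsPRM Λ P) (f : SimpleFunc E ℝ) :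
    ∫ ξ, Complex.exp ((∫ x, f x ∂ξ.1 : ℝ) * Complex.I) ∂P =
      Complex.exp (∫ x, (Complex.exp (f x * Complex.I) - 1) ∂Λ) := by
  classical
  have hP1 := hP.isProbabilityMeasure
  let e := f.range.equivFin
  let B : Fin f.range.card → Set E := fun i => f ⁻¹' {(e.symm i : ℝ)}
  have hB : ∀ i, MeasurableSet (B i) := fun i => f.measurableSet_fiber _
  have hdisj : Pairwise fun i j => Disjoint (B i) (B j) := by
    intro i j hij
    refine Disjoint.preimage _ (Set.disjoint_singleton.mpr fun h => hij ?_)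
    exact e.symm.injective (Subtype.ext h)
  have hsum : ∀ g : ℝ → ℂ, ∑ y ∈ f.range, g y = ∑ i, g (e.symm i) := fun g => by
    rw [e.symm.sum_comp (fun y : f.range => g y), Finset.sum_coe_sort]
  have h1 : ∀ ξ : PointMeasure E, Complex.exp ((∫ x, f x ∂ξ.1 : ℝ) * Complex.I) =
      ∏ i, Complex.exp (((ξ.1 (B i)).toReal * (e.symm i : ℝ) : ℝ) * Complex.I) := by
    intro ξ
    rw [← SimpleFunc.integral_eq_integral f (SimpleFunc.integrable_of_isFiniteMeasure f),
      SimpleFunc.integral_eq, ← Complex.exp_sum, ← Finset.sum_mul, Complex.ofReal_sum,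
      hsum (fun y => ((ξ.1.real (f ⁻¹' {y}) • y : ℝ) : ℂ))]
    rfl
  have h2 := (hP.indep _ B hB hdisj).integral_fun_prod_comp (𝕜 := ℂ)
    (f := fun i x => Complex.exp ((x.toReal * (e.symm i : ℝ) : ℝ) * Complex.I))
    (fun i => (PointMeasure.measurable_apply (hB i)).aemeasurable)
    (fun i => by
      have : Measurable fun x : ℝ≥0∞ => x.toReal := ENNReal.measurable_toReal
      exact (by fun_prop : Measurable _).aestronglyMeasurable)
  simp_rw [h1]
  rw [h2, Finset.prod_congr rfl fun i _ => hP.integral_comp_count (hB i) _, ← Complex.exp_sum]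
  congr 1
  let g : SimpleFunc E ℂ := f.map fun y : ℝ => Complex.exp (y * Complex.I) - 1
  have h3 : ∫ x, (Complex.exp (f x * Complex.I) - 1) ∂Λ = ∫ x, g x ∂Λ := rfl
  rw [h3, ← SimpleFunc.integral_eq_integral g (SimpleFunc.integrable_of_isFiniteMeasure g),
    SimpleFunc.map_integral f _ (SimpleFunc.integrable_of_isFiniteMeasure f)
      (by simp)]
  rw [hsum (fun y => Λ.real (f ⁻¹' {y}) • (Complex.exp (y * Complex.I) - 1))]
  simp [B, Complex.real_smul]

/-- The hypothesis fixes the joint characteristic functions of finitely many counts, hence all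
finite-dimensional laws of the family `B ↦ ξ B`, and this family generates the σ-algebra. -/
theorem PointMeasure.measure_ext_of_integral_cexp {P Q : Measure (PointMeasure E)}
    [IsProbabilityMeasure P] [IsProbabilityMeasure Q]
    (h : ∀ f : SimpleFunc E ℝ, ∫ ξ, Complex.exp ((∫ x, f x ∂ξ.1 : ℝ) * Complex.I) ∂P =
      ∫ ξ, Complex.exp ((∫ x, f x ∂ξ.1 : ℝ) * Complex.I) ∂Q) : P = Q := by
  classical
  let Φ : PointMeasure E → {B : Set E // MeasurableSet B} → ℝ := fun ξ B => (ξ.1 B.1).toReal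
  have hΦ : Measurable Φ := measurable_pi_lambda _ fun B =>
    (PointMeasure.measurable_apply B.2).ennreal_toReal
  have hfin : ∀ I : Finset {B : Set E // MeasurableSet B},
      (P.map Φ).map I.restrict = (Q.map Φ).map I.restrict := by
    intro I
    have hI : Measurable (I.restrict (π := fun _ => ℝ)) := Finset.measurable_restrict I
    have := Measure.isProbabilityMeasure_map (μ := P) hΦ.aemeasurable
    have := Measure.isProbabilityMeasure_map (μ := Q) hΦ.aemeasurable
    refine Measure.ext_of_charFunDual (funext fun L => ?_)
    have hL : ∀ v : I → ℝ, L v = ∑ i, v i * L (Pi.single i 1) := fun v => by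
      conv_lhs => rw [← Finset.univ_sum_single v, map_sum]
      refine Finset.sum_congr rfl fun i _ => ?_
      rw [← smul_eq_mul, ← map_smul, ← Pi.single_smul, smul_eq_mul, mul_one]
    -- Chosen so that its integral against `ξ` is the functional `L` applied to the counts of `ξ`;
    -- the sets indexed by `I` may overlap.
    let f : SimpleFunc E ℝ := ∑ i : I,
      SimpleFunc.piecewise i.1.1 i.1.2 (SimpleFunc.const E (L (Pi.single i 1))) 0
    have hf : ∀ ξ : PointMeasure E, ∫ x, f x ∂ξ.1 = L (I.restrict (Φ ξ)) := by
      intro ξ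
      have h0 : ∀ x, f x = ∑ i : I, i.1.1.indicator (fun _ => L (Pi.single i 1)) x := by
        intro x
        rw [SimpleFunc.finsetSum_apply]
        refine Finset.sum_congr rfl fun i _ => ?_
        simp [SimpleFunc.coe_piecewise, Set.piecewise, Set.indicator_apply]
      simp_rw [h0]
      rw [integral_finsetSum _ fun i _ => (integrable_const _).indicator i.1.2, hL]
      refine Finset.sum_congr rfl fun i _ => ?_
      rw [integral_indicator_const _ i.1.2]
      rfl
    simp only [charFunDual_apply]
    rw [integral_map hI.aemeasurable (by fun_prop), integral_map hΦ.aemeasurable,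
      integral_map hI.aemeasurable (by fun_prop), integral_map hΦ.aemeasurable]
    · simpa only [hf] using h f
    · exact (by fun_prop : Measurable _).aestronglyMeasurable
    · exact (by fun_prop : Measurable _).aestronglyMeasurable
  have hmap : P.map Φ = Q.map Φ := by
    have := Measure.isProbabilityMeasure_map (μ := P) hΦ.aemeasurable
    have := Measure.isProbabilityMeasure_map (μ := Q) hΦ.aemeasurable
    have hI : ∀ I : Finset {B : Set E // MeasurableSet B},
      IsFiniteMeasure ((P.map Φ).map I.restrict) := fun I => inferInstance
    exact IsProjectiveLimit.unique (P := fun I => (P.map Φ).map I.restrict) (fun I => rfl)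
      (fun I => (hfin I).symm)
  -- Counts are finite, so passing to real values in `Φ` loses no information.
  have hcomap : (inferInstance : MeasurableSpace (PointMeasure E)) ≤
      MeasurableSpace.comap Φ inferInstance := by
    have : Measurable[MeasurableSpace.comap Φ inferInstance]
        (Subtype.val : PointMeasure E → Measure E) := by
      let : MeasurableSpace (PointMeasure E) := MeasurableSpace.comap Φ inferInstance
      refine Measure.measurable_of_measurable_coe _ fun B hB => ?_
      have h1 : Measurable fun ξ : PointMeasure E => Φ ξ ⟨B, hB⟩ :=
        (measurable_pi_apply _).comp (comap_measurable Φ)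
      have h2 : (fun ξ : PointMeasure E => ξ.1 B) =
          fun ξ => ENNReal.ofReal (Φ ξ ⟨B, hB⟩) := by
        ext ξ
        exact (ENNReal.ofReal_toReal (measure_ne_top _ _)).symm
      rw [h2]
      exact h1.ennreal_ofReal
    exact this.comap_le
  refine Measure.ext fun s hs => ?_
  obtain ⟨t, ht, rfl⟩ := hcomap s hs
  rw [← Measure.map_apply hΦ ht, hmap, Measure.map_apply hΦ ht]

theorem IsPRM.eq_poissonLaw {Λ : Measure E} [IsFiniteMeasure Λ]
    {P : Measure (PointMeasure E)} (hP : IsPRM Λ P) : P = poissonLaw Λ := by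
  have := hP.isProbabilityMeasure
  exact PointMeasure.measure_ext_of_integral_cexp fun f => by
    rw [hP.integral_cexp f, integral_cexp_poissonLaw Λ f]

end Uniqueness

/-! ### Common parts of measures -/

section CommonPart

variable {E : Type*} [MeasurableSpace E]

/-- Both sides are `max(μ, ν)`. The truncated differences are the two Jordan parts of `μ - ν`, so
the identity can be read off from signed measures. -/
theorem MeasureTheory.Measure.add_sub_eq_add_sub (μ ν : Measure E) [IsFiniteMeasure μ]
    [IsFiniteMeasure ν] : μ + (ν - μ) = ν + (μ - ν) := by
  have h := Measure.sub_toSignedMeasure_eq_toSignedMeasure_sub (μ := μ) (ν := ν)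
  rw [sub_eq_sub_iff_add_eq_add] at h
  refine Measure.ext fun s hs => ?_
  have hs' := congrArg (fun v : SignedMeasure E => v s) h
  simp only [_root_.add_apply, Measure.toSignedMeasure_apply_measurable hs] at hs'
  rw [← measureReal_eq_measureReal_iff, measureReal_add_apply, measureReal_add_apply, hs',
    add_comm]

/-- Two finite measures have a common part whose complements are the truncated differences. -/
theorem MeasureTheory.Measure.exists_common_part (μ ν : Measure E) [IsFiniteMeasure μ]
    [IsFiniteMeasure ν] : ∃ c : Measure E, c + (μ - ν) = μ ∧ c + (ν - μ) = ν := by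
  -- This witness is `min(μ, ν)`.
  refine ⟨μ - (μ - ν), Measure.sub_add_cancel_of_le Measure.sub_le, ?_⟩
  have h := Measure.add_sub_eq_add_sub μ ν
  have h1 := Measure.sub_add_cancel_of_le (Measure.sub_le : μ - ν ≤ μ)
  refine Measure.ext fun s _ => ?_
  have hs := congrArg (fun m : Measure E => m s) h
  have hs1 := congrArg (fun m : Measure E => m s) h1
  simp only [Measure.add_apply] at hs hs1 ⊢
  refine (ENNReal.add_left_inj (measure_ne_top (μ - ν) s)).mp ?_
  rw [← hs, add_right_comm, hs1]

theorem absDiff_comm (μ ν : Measure E) : absDiff μ ν = absDiff ν μ := add_comm _ _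

instance isFiniteMeasure_absDiff (μ ν : Measure E) [IsFiniteMeasure μ] [IsFiniteMeasure ν] :
    IsFiniteMeasure (absDiff μ ν) := by
  unfold absDiff; infer_instance

/-- If two probability measures have a common part of mass `t`, their integrals of a function that
oscillates by at most `1` differ by at most `1 - t`. -/
theorem abs_integral_sub_integral_le_of_common_part {X : Type*} [MeasurableSpace X]
    {P Q ρ : Measure X} [IsProbabilityMeasure P] [IsProbabilityMeasure Q] [IsFiniteMeasure ρ]
    (hP : ρ ≤ P) (hQ : ρ ≤ Q) {h : X → ℝ} (hh : Measurable h) {a : ℝ}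
    (ha : ∀ x, |h x - a| ≤ 1 / 2) :
    |∫ x, h x ∂P - ∫ x, h x ∂Q| ≤ 1 - ρ.real Set.univ := by
  have hb : ∀ (μ : Measure X) [IsFiniteMeasure μ], Integrable (fun x => h x - a) μ :=
    fun μ _ => Integrable.of_bound (C := 1 / 2) (hh.sub_const a).aestronglyMeasurable
      (ae_of_all _ ha)
  have hb' : ∀ (μ : Measure X) [IsFiniteMeasure μ], Integrable h μ := fun μ _ => by
    simpa [Pi.add_def] using (hb μ).add (integrable_const a)
  -- The integrals over `ρ` cancel in the difference. Each remainder has mass `1 - ρ(X)` and its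
  -- integrand is at most `1/2` in absolute value.
  have key : ∀ (μ : Measure X) [IsProbabilityMeasure μ], ρ ≤ μ →
      ∫ x, h x ∂μ = a + ∫ x, (h x - a) ∂ρ + ∫ x, (h x - a) ∂(μ - ρ) ∧
      |∫ x, (h x - a) ∂(μ - ρ)| ≤ (1 - ρ.real Set.univ) / 2 := by
    intro μ _ hμ
    have hadd := Measure.sub_add_cancel_of_le hμ
    constructor
    · have h1 : ∫ x, (h x - a) ∂μ = ∫ x, h x ∂μ - a := by
        rw [integral_sub (hb' μ) (integrable_const a)]; simp
      have h2 : ∫ x, (h x - a) ∂μ = ∫ x, (h x - a) ∂(μ - ρ) + ∫ x, (h x - a) ∂ρ := by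
        rw [← integral_add_measure (hb _) (hb _), hadd]
      linarith
    · have h1 := norm_integral_le_of_norm_le_const (μ := μ - ρ) (f := fun x => h x - a)
        (ae_of_all _ ha)
      have h2 : (μ - ρ).real Set.univ + ρ.real Set.univ = 1 := by
        rw [← measureReal_add_apply, hadd, probReal_univ]
      rw [Real.norm_eq_abs] at h1
      linarith
  obtain ⟨h1, h2⟩ := key P hP
  obtain ⟨h3, h4⟩ := key Q hQ
  rw [h1, h3]
  have := abs_sub (∫ x, (h x - a) ∂(P - ρ)) (∫ x, (h x - a) ∂(Q - ρ))
  calc _ = |∫ x, (h x - a) ∂(P - ρ) - ∫ x, (h x - a) ∂(Q - ρ)| := by congr 1; ring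
    _ ≤ _ := by linarith

end CommonPart

/-! ### Comparison of Poisson laws through a common part of the mean measures -/

section TotalVariation

variable {E : Type*} [MeasurableSpace E]

/-- The product outer measure is the largest one bounded on boxes by the product of the side masses,
so a comparison on boxes suffices. -/
theorem MeasureTheory.Measure.pi_le_pi {ι : Type*} [Fintype ι] {X : ι → Type*}
    [∀ i, MeasurableSpace (X i)] {μ ν : ∀ i, Measure (X i)} (h : ∀ i, μ i ≤ ν i) :
    Measure.pi μ ≤ Measure.pi ν := by
  have hle : OuterMeasure.pi (fun i => (μ i).toOuterMeasure) ≤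
      OuterMeasure.pi fun i => (ν i).toOuterMeasure := by
    rw [OuterMeasure.le_pi]
    intro s _
    refine (OuterMeasure.pi_pi_le _ s).trans ?_
    exact Finset.prod_le_prod' fun i _ => h i (s i)
  refine Measure.le_iff.mpr fun s hs => ?_
  rw [Measure.pi, Measure.pi, toMeasure_apply _ _ hs, toMeasure_apply _ _ hs]
  exact hle s

/-- The factor is the probability that an independent Poisson process with mean `Λ - c` is empty. In
the mixture this is the termwise comparison `c^{⊗k} ≤ Λ^{⊗k}`. -/
theorem poissonLaw_common_part {c Λ : Measure E} [IsFiniteMeasure Λ] (h : c ≤ Λ) :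
    ENNReal.ofReal (Real.exp (-(Λ.real Set.univ - c.real Set.univ))) • poissonLaw c ≤
      poissonLaw Λ := by
  refine Measure.le_iff.mpr fun s hs => ?_
  rw [Measure.smul_apply, poissonLaw, poissonLaw, Measure.sum_apply _ hs, Measure.sum_apply _ hs,
    smul_eq_mul, ← ENNReal.tsum_mul_left]
  refine ENNReal.tsum_le_tsum fun k => ?_
  simp only [Measure.smul_apply, smul_eq_mul]
  rw [← mul_assoc, ← ENNReal.ofReal_mul (Real.exp_nonneg _), mul_div_assoc', ← Real.exp_add,
    Measure.map_apply (PointMeasure.measurable_ofFun k) hs,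
    Measure.map_apply (PointMeasure.measurable_ofFun k) hs]
  have e : -(Λ.real Set.univ - c.real Set.univ) + -c.real Set.univ = -Λ.real Set.univ := by ring
  rw [e]
  gcongr
  exact Measure.pi_le_pi fun _ : Fin k => h

theorem abs_integral_poissonLaw_sub_le (Λ Λ' : Measure E) [IsFiniteMeasure Λ]
    [IsFiniteMeasure Λ'] {h : PointMeasure E → ℝ} (hh : Measurable h) {a : ℝ}
    (ha : ∀ x, |h x - a| ≤ 1 / 2) :
    |∫ ξ, h ξ ∂(poissonLaw Λ) - ∫ ξ, h ξ ∂(poissonLaw Λ')| ≤ (absDiff Λ Λ').real Set.univ := by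
  obtain ⟨c, hc, hc'⟩ := Measure.exists_common_part Λ Λ'
  have hcΛ : c ≤ Λ := hc ▸ Measure.le_add_right le_rfl
  have hcΛ' : c ≤ Λ' := hc' ▸ Measure.le_add_right le_rfl
  have := isFiniteMeasure_of_le Λ hcΛ
  have e1 : Λ.real Set.univ = c.real Set.univ + (Λ - Λ').real Set.univ := by
    rw [← measureReal_add_apply, hc]
  have e2 : Λ'.real Set.univ = c.real Set.univ + (Λ' - Λ).real Set.univ := by
    rw [← measureReal_add_apply, hc']
  have e3 : (absDiff Λ Λ').real Set.univ = (Λ - Λ').real Set.univ + (Λ' - Λ).real Set.univ :=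
    measureReal_add_apply ..
  have n1 : 0 ≤ (Λ - Λ').real Set.univ := measureReal_nonneg
  have n2 : 0 ≤ (Λ' - Λ).real Set.univ := measureReal_nonneg
  set V := (absDiff Λ Λ').real Set.univ
  have hle : ∀ d : ℝ, d ≤ V → ENNReal.ofReal (Real.exp (-V)) • poissonLaw c ≤
      ENNReal.ofReal (Real.exp (-d)) • poissonLaw c := by
    intro d hd
    refine Measure.le_iff.mpr fun s _ => ?_
    simp only [Measure.smul_apply, smul_eq_mul]
    gcongr
  have hfin : IsFiniteMeasure (ENNReal.ofReal (Real.exp (-V)) • poissonLaw c) :=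
    Measure.smul_finite _ ENNReal.ofReal_ne_top
  have h1 := abs_integral_sub_integral_le_of_common_part
    ((hle _ (by linarith)).trans (poissonLaw_common_part hcΛ))
    ((hle _ (by linarith)).trans (poissonLaw_common_part hcΛ')) hh ha
  refine h1.trans ?_
  rw [measureReal_ennreal_smul_apply, probReal_univ, mul_one,
    ENNReal.toReal_ofReal (Real.exp_nonneg _)]
  linarith [Real.add_one_le_exp (-V)]

theorem dTV_poissonLaw_le (Λ Λ' : Measure E) [IsFiniteMeasure Λ] [IsFiniteMeasure Λ'] :
    dTV (poissonLaw Λ) (poissonLaw Λ') ≤ absDiff Λ Λ' Set.univ := by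
  refine iSup₂_le fun B hB => ENNReal.ofReal_le_of_le_toReal ?_
  have h := abs_integral_poissonLaw_sub_le Λ Λ' (h := B.indicator 1)
    (measurable_one.indicator hB) (a := 1 / 2) (fun ξ => by
      by_cases hξ : ξ ∈ B
      · norm_num [hξ, abs_of_pos]
      · norm_num [hξ, abs_of_pos])
  simpa [integral_indicator_one hB, measureReal_def] using h

end TotalVariation

/-! ### Poisson distributions with different means -/

section PoissonCounts

/-- The probabilities of the Poisson distribution with mean `r`. -/
def poissonWeight (r : ℝ) (k : ℕ) : ℝ := Real.exp (-r) / k.factorial * r ^ k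

theorem poissonWeight_nonneg {r : ℝ} (hr : 0 ≤ r) (k : ℕ) : 0 ≤ poissonWeight r k := by
  unfold poissonWeight; positivity

theorem hasSum_poissonWeight (r : ℝ) : HasSum (poissonWeight r) 1 := hasSum_poisson r

/-- The total variation distance of two Poisson distributions is at most the difference of the
square roots of their means. -/
theorem tsum_abs_poissonWeight_sub_le {x y : ℝ} (hx : 0 ≤ x) (hxy : x ≤ y) :
    ∑' k, |poissonWeight y k - poissonWeight x k| ≤ 2 * (√y - √x) := by
  rcases hxy.eq_or_lt with rfl | hlt
  · simp
  have hy : 0 ≤ y := hx.trans hxy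
  set d := √y - √x with hd
  have hdpos : 0 < d := sub_pos.mpr (Real.sqrt_lt_sqrt hx hlt)
  have hsx := Real.sq_sqrt hx
  have hsy := Real.sq_sqrt hy
  -- This is the geometric mean of the two weights; its sum `exp(-d²/2)` is the Hellinger affinity.
  let r : ℕ → ℝ := fun k => Real.exp (-d ^ 2 / 2) * poissonWeight (√x * √y) k
  have hr0 : ∀ k, 0 ≤ r k := fun k =>
    mul_nonneg (Real.exp_nonneg _) (poissonWeight_nonneg (by positivity) k)
  have hr2 : ∀ k, r k ^ 2 = poissonWeight x k * poissonWeight y k := fun k => by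
    have e1 : Real.exp (-d ^ 2 / 2) ^ 2 * Real.exp (-(√x * √y)) ^ 2 =
        Real.exp (-x) * Real.exp (-y) := by
      rw [← Real.exp_nat_mul, ← Real.exp_nat_mul, ← Real.exp_add, ← Real.exp_add]
      congr 1
      push_cast
      rw [hd]
      linear_combination -hsx - hsy
    have e2 : ((√x * √y) ^ k) ^ 2 = x ^ k * y ^ k := by
      rw [← pow_mul, mul_comm k 2, pow_mul, mul_pow, hsx, hsy, mul_pow]
    simp only [r, poissonWeight]
    calc _ = (Real.exp (-d ^ 2 / 2) ^ 2 * Real.exp (-(√x * √y)) ^ 2) * ((√x * √y) ^ k) ^ 2 /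
          (k.factorial : ℝ) ^ 2 := by ring
      _ = _ := by rw [e1, e2]; ring
  have hrs : HasSum r (Real.exp (-d ^ 2 / 2)) := by
    simpa using (hasSum_poissonWeight (√x * √y)).mul_left (Real.exp (-d ^ 2 / 2))
  have hpq := (hasSum_poissonWeight y).add (hasSum_poissonWeight x)
  have hmaj := ((hpq.sub (hrs.mul_left 2)).mul_left (1 / d)).add
    ((hpq.add (hrs.mul_left 2)).mul_left (d / 4))
  -- With `p`, `q` the two weights, `|q - p| = |√q - √p| (√q + √p)`, and AM-GM bounds this by `(√q -
  -- √p)²/d + d(√q + √p)²/4`. The scale `d` makes each of the two sums at most `d`.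
  have hle : ∀ k, |poissonWeight y k - poissonWeight x k| ≤
      1 / d * (poissonWeight y k + poissonWeight x k - 2 * r k) +
        d / 4 * (poissonWeight y k + poissonWeight x k + 2 * r k) := by
    intro k
    have hp := poissonWeight_nonneg hx k
    have hq := poissonWeight_nonneg hy k
    have h2 := hr2 k
    have h0 := hr0 k
    generalize poissonWeight x k = p at *
    generalize poissonWeight y k = q at *
    generalize r k = s at *
    have hs : 2 * s ≤ q + p := by
      refine abs_le_of_sq_le_sq' ?_ (by linarith) |>.2
      nlinarith [sq_nonneg (q - p)]
    have hA : 0 ≤ 1 / d * (q + p - 2 * s) := mul_nonneg (by positivity) (by linarith)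
    have hB : 0 ≤ d / 4 * (q + p + 2 * s) := mul_nonneg (by positivity) (by linarith)
    refine abs_le_of_sq_le_sq ?_ (add_nonneg hA hB)
    have hAB : 1 / d * (q + p - 2 * s) * (d / 4 * (q + p + 2 * s)) = (q - p) ^ 2 / 4 := by
      field_simp
      linear_combination (-4) * h2
    nlinarith [sq_nonneg (1 / d * (q + p - 2 * s) - d / 4 * (q + p + 2 * s))]
  have hsum : Summable fun k => |poissonWeight y k - poissonWeight x k| :=
    Summable.of_nonneg_of_le (fun k => abs_nonneg _) hle hmaj.summable
  refine (hasSum_le hle hsum.hasSum hmaj).trans ?_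
  have hB1 : 1 - d ^ 2 / 2 ≤ Real.exp (-d ^ 2 / 2) := by
    linarith [Real.add_one_le_exp (-d ^ 2 / 2)]
  have hB2 : Real.exp (-d ^ 2 / 2) ≤ 1 := Real.exp_le_one_iff.mpr (by nlinarith)
  have i1 : 1 / d * (1 + 1 - 2 * Real.exp (-d ^ 2 / 2)) ≤ d := by
    rw [one_div, inv_mul_le_iff₀ hdpos]; linarith
  have i2 : d / 4 * (1 + 1 + 2 * Real.exp (-d ^ 2 / 2)) ≤ d := by nlinarith
  linarith

/-- Separates the change of the conditional values, which costs `D`, from the change of the count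
law. The bound `1/2` on `b` cancels the factor `2` of the preceding estimate. -/
theorem abs_tsum_poissonWeight_sub_le {x y : ℝ} (hx : 0 ≤ x) (hxy : x ≤ y) {D A B : ℝ}
    {a b : ℕ → ℝ} (hab : ∀ k, |a k - b k| ≤ D) (hb : ∀ k, |b k| ≤ 1 / 2)
    (hA : HasSum (fun k => poissonWeight y k * a k) A)
    (hB : HasSum (fun k => poissonWeight x k * b k) B) :
    |A - B| ≤ D + (√y - √x) := by
  have hy := hx.trans hxy
  have hdiff : Summable fun k => |poissonWeight y k - poissonWeight x k| :=
    ((hasSum_poissonWeight y).summable.sub (hasSum_poissonWeight x).summable).abs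
  have hmaj := ((hasSum_poissonWeight y).mul_right D).add (hdiff.hasSum.mul_right (1 / 2))
  have hle : ∀ k, |poissonWeight y k * a k - poissonWeight x k * b k| ≤
      poissonWeight y k * D + |poissonWeight y k - poissonWeight x k| * (1 / 2) := by
    intro k
    have e : poissonWeight y k * a k - poissonWeight x k * b k =
      poissonWeight y k * (a k - b k) + (poissonWeight y k - poissonWeight x k) * b k := by ring
    rw [e]
    refine (abs_add_le _ _).trans ?_
    rw [abs_mul, abs_mul, abs_of_nonneg (poissonWeight_nonneg hy k)]
    exact add_le_add (mul_le_mul_of_nonneg_left (hab k) (poissonWeight_nonneg hy k))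
      (mul_le_mul_of_nonneg_left (hb k) (abs_nonneg _))
  have h1 := (hA.sub hB).norm_le_of_bounded hmaj hle
  have h2 := tsum_abs_poissonWeight_sub_le hx hxy
  rw [Real.norm_eq_abs] at h1
  linarith

end PoissonCounts

/-! ### Coupling of product measures -/

section Coupling

variable {E : Type*} [MeasurableSpace E]

/-- Two probability measures with a common part `c` have a coupling that is off the diagonal with
probability at most `1 - c(E)`. -/
theorem exists_coupling [MeasurableEq E] {μ ν c : Measure E} [IsProbabilityMeasure μ]
    [IsProbabilityMeasure ν] (hμ : c ≤ μ) (hν : c ≤ ν) :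
    ∃ π : Measure (E × E), IsProbabilityMeasure π ∧ π.map Prod.fst = μ ∧ π.map Prod.snd = ν ∧
      π.real (Set.diagonal E)ᶜ ≤ 1 - c.real Set.univ := by
  have := isFiniteMeasure_of_le μ hμ
  have hμc := Measure.sub_add_cancel_of_le hμ
  have hνc := Measure.sub_add_cancel_of_le hν
  set t := (μ - c) Set.univ with ht
  have h1 : t + c Set.univ = 1 := by
    rw [ht, ← Measure.add_apply, hμc, measure_univ]
  have h2 : (ν - c) Set.univ = t := by
    have h3 : (ν - c) Set.univ + c Set.univ = 1 := by
      rw [← Measure.add_apply, hνc, measure_univ]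
    exact (ENNReal.add_left_inj (measure_ne_top c _)).mp (h3.trans h1.symm)
  have htop : t ≠ ⊤ := measure_ne_top _ _
  -- Covers `t = 0` as well: there the scalar is not `1`, but `m` vanishes.
  have hscale : ∀ m : Measure E, m Set.univ = t → (t⁻¹ * t) • m = m := by
    intro m hm
    rcases eq_or_ne t 0 with h0 | h0
    · rw [Measure.measure_univ_eq_zero.mp (hm.trans h0), smul_zero]
    · rw [ENNReal.inv_mul_cancel h0 htop, one_smul]
  have hdiag : Measurable fun x : E => (x, x) := measurable_id.prodMk measurable_id
  -- The common part is placed on the diagonal and the two remainders, both of mass `t`, are coupled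
  -- independently.
  let π : Measure (E × E) := t⁻¹ • (μ - c).prod (ν - c) + c.map fun x => (x, x)
  have hfst : π.map Prod.fst = μ := by
    rw [Measure.map_add _ _ measurable_fst, Measure.map_smul, Measure.map_fst_prod, h2,
      Measure.map_map measurable_fst hdiag, smul_smul, hscale _ rfl]
    simpa [Function.comp_def, Measure.map_id'] using hμc
  have hsnd : π.map Prod.snd = ν := by
    rw [Measure.map_add _ _ measurable_snd, Measure.map_smul, Measure.map_snd_prod, ← ht,
      Measure.map_map measurable_snd hdiag, smul_smul, hscale _ h2]
    simpa [Function.comp_def, Measure.map_id'] using hνc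
  refine ⟨π, ⟨?_⟩, hfst, hsnd, ?_⟩
  · rw [← measure_univ (μ := μ), ← hfst, Measure.map_apply measurable_fst MeasurableSet.univ,
      Set.preimage_univ]
  · have hD : MeasurableSet (Set.diagonal E)ᶜ := measurableSet_diagonal.compl
    have hz : (c.map fun x => (x, x)) (Set.diagonal E)ᶜ = 0 := by
      rw [Measure.map_apply hdiag hD]
      simp [Set.preimage]
    have hle : π (Set.diagonal E)ᶜ ≤ t := by
      rw [Measure.add_apply, hz, add_zero, Measure.smul_apply, smul_eq_mul]
      calc _ ≤ t⁻¹ * (μ - c).prod (ν - c) Set.univ := by gcongr; exact Set.subset_univ _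
        _ = t⁻¹ * t * t := by
          rw [← Set.univ_prod_univ, Measure.prod_prod, h2, ← ht, mul_assoc]
        _ ≤ 1 * t := by gcongr; exact ENNReal.inv_mul_le_one t
        _ = t := one_mul t
    have h3 : t.toReal + c.real Set.univ = 1 := by
      rw [measureReal_def, ← ENNReal.toReal_add htop (measure_ne_top c _), h1, ENNReal.toReal_one]
    have h4 : π.real (Set.diagonal E)ᶜ ≤ t.toReal := ENNReal.toReal_mono htop hle
    linarith

/-- Integrals over product measures, for functions that change by at most the proportion of changed
coordinates. -/
theorem abs_integral_pi_sub_integral_pi_le [MeasurableEq E] {μ ν c : Measure E}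
    [IsProbabilityMeasure μ] [IsProbabilityMeasure ν] (hμ : c ≤ μ) (hν : c ≤ ν) {k : ℕ}
    {g : (Fin k → E) → ℝ} (hg : Measurable g) {C : ℝ} (hC : ∀ x, |g x| ≤ C)
    (hgl : ∀ x y : Fin k → E, |g x - g y| ≤
      (k : ℝ)⁻¹ * ∑ i, (Set.diagonal E)ᶜ.indicator 1 (x i, y i)) :
    |∫ x, g x ∂(Measure.pi fun _ : Fin k => μ) - ∫ x, g x ∂(Measure.pi fun _ : Fin k => ν)| ≤
      1 - c.real Set.univ := by
  -- With `k` independent copies of the coupling, the expected proportion of changed coordinates is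
  -- at most the mass of `π` off the diagonal.
  obtain ⟨π, hπ, hfst, hsnd, hdiag⟩ := exists_coupling hμ hν
  have hD : MeasurableSet (Set.diagonal E)ᶜ := measurableSet_diagonal.compl
  have m1 : Measurable fun (w : Fin k → E × E) i => (w i).1 := by fun_prop
  have m2 : Measurable fun (w : Fin k → E × E) i => (w i).2 := by fun_prop
  have e1 : (Measure.pi fun _ : Fin k => π).map (fun w i => (w i).1) =
      Measure.pi fun _ : Fin k => μ := by
    have : ∀ i : Fin k, SigmaFinite (π.map (Prod.fst : E × E → E)) := fun i => by
      rw [hfst]; infer_instance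
    rw [Measure.pi_map_pi (fun i => measurable_fst.aemeasurable), hfst]
  have e2 : (Measure.pi fun _ : Fin k => π).map (fun w i => (w i).2) =
      Measure.pi fun _ : Fin k => ν := by
    have : ∀ i : Fin k, SigmaFinite (π.map (Prod.snd : E × E → E)) := fun i => by
      rw [hsnd]; infer_instance
    rw [Measure.pi_map_pi (fun i => measurable_snd.aemeasurable), hsnd]
  have hint : ∀ φ : (Fin k → E × E) → Fin k → E, Measurable φ →
      Integrable (fun w => g (φ w)) (Measure.pi fun _ : Fin k => π) := fun φ hφ =>
    Integrable.of_bound (C := C) (hg.comp hφ).aestronglyMeasurable (ae_of_all _ fun w => hC _)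
  rw [← e1, ← e2, integral_map m1.aemeasurable hg.aestronglyMeasurable,
    integral_map m2.aemeasurable hg.aestronglyMeasurable, ← integral_sub (hint _ m1) (hint _ m2)]
  have hind : ∀ i : Fin k, Integrable
      (fun w : Fin k → E × E => (Set.diagonal E)ᶜ.indicator (1 : E × E → ℝ) (w i))
      (Measure.pi fun _ : Fin k => π) := fun i =>
    integrable_comp_eval (μ := fun _ : Fin k => π)
      ((integrable_const (1 : ℝ)).indicator hD : Integrable _ π)
  have hval : ∀ i : Fin k,
      ∫ w, (Set.diagonal E)ᶜ.indicator (1 : E × E → ℝ) (w i) ∂(Measure.pi fun _ : Fin k => π) =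
        π.real (Set.diagonal E)ᶜ := fun i => by
    rw [integral_comp_eval (μ := fun _ : Fin k => π)
      (measurable_one.indicator hD).aestronglyMeasurable, integral_indicator_one hD]
  calc |∫ w, (g (fun i => (w i).1) - g (fun i => (w i).2)) ∂(Measure.pi fun _ : Fin k => π)|
      ≤ ∫ w, |g (fun i => (w i).1) - g (fun i => (w i).2)| ∂(Measure.pi fun _ : Fin k => π) :=
        abs_integral_le_integral_abs
    _ ≤ ∫ w, (k : ℝ)⁻¹ * ∑ i, (Set.diagonal E)ᶜ.indicator 1 (w i)
          ∂(Measure.pi fun _ : Fin k => π) :=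
        integral_mono ((hint _ m1).sub (hint _ m2)).abs
          ((integrable_finsetSum _ fun i _ => hind i).const_mul _) fun w => hgl _ _
    _ = (k : ℝ)⁻¹ * (k * π.real (Set.diagonal E)ᶜ) := by
        rw [integral_const_mul, integral_finsetSum _ fun i _ => hind i,
          Finset.sum_congr rfl fun i _ => hval i]
        simp
    _ ≤ π.real (Set.diagonal E)ᶜ := by
        -- Only an inequality, because `k⁻¹ * k` is `0` when `k = 0`.
        rw [← mul_assoc]
        exact mul_le_of_le_one_left measureReal_nonneg (inv_mul_le_one)
    _ ≤ 1 - c.real Set.univ := hdiag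

end Coupling

/-! ### The distance `d₂` of Poisson laws -/

section D2

variable {E : Type*} [MeasurableSpace E]

/-- Matching the points in the given order already bounds the Wasserstein distance. The test
functions `κ` need not be measurable, so the Dirac integrals are evaluated using measurable
singletons. -/
theorem d1_ofFun_le [MeasurableSingletonClass E] {d₀ : E → E → ℝ} (hnn : ∀ x y, 0 ≤ d₀ x y)
    {k : ℕ} (x y : Fin k → E) :
    d1 d₀ (PointMeasure.ofFun x).1 (PointMeasure.ofFun y).1 ≤
      (k : ℝ)⁻¹ * ∑ i, d₀ (x i) (y i) := by
  have hint : ∀ (z : Fin k → E) (κ : E → ℝ),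
      ∫ x, κ x ∂(PointMeasure.ofFun z).1 = ∑ i, κ (z i) := fun z κ => by
    simp only [PointMeasure.ofFun]
    rw [integral_finsetSum_measure fun i _ => integrable_dirac (by simp)]
    simp
  rw [d1, if_neg (by simp [PointMeasure.ofFun_univ]), measureReal_def, PointMeasure.ofFun_univ,
    ENNReal.toReal_natCast]
  refine mul_le_mul_of_nonneg_left ?_ (by positivity)
  have : Nonempty {κ : E → ℝ // ∀ x y, |κ x - κ y| ≤ d₀ x y} :=
    ⟨0, fun x y => by simpa using hnn x y⟩
  refine ciSup_le fun κ => ?_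
  rw [hint, hint, ← Finset.sum_sub_distrib]
  exact (Finset.abs_sum_le_sum_abs _ _).trans (Finset.sum_le_sum fun i _ => κ.2 _ _)

theorem d1_le_one [MeasurableSingletonClass E] {d₀ : E → E → ℝ} (hnn : ∀ x y, 0 ≤ d₀ x y)
    (hle : ∀ x y, d₀ x y ≤ 1) (ξ₁ ξ₂ : PointMeasure E) : d1 d₀ ξ₁.1 ξ₂.1 ≤ 1 := by
  obtain ⟨k, x, rfl⟩ := ξ₁.exists_eq_ofFun
  obtain ⟨l, y, rfl⟩ := ξ₂.exists_eq_ofFun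
  by_cases hkl : k = l
  · subst hkl
    refine (d1_ofFun_le hnn x y).trans ?_
    calc (k : ℝ)⁻¹ * ∑ i, d₀ (x i) (y i) ≤ (k : ℝ)⁻¹ * ∑ _i : Fin k, 1 := by
          gcongr; exact hle _ _
      _ ≤ 1 := by simpa using inv_mul_le_one
  · rw [d1, if_pos (by simpa [PointMeasure.ofFun_univ] using hkl)]

/-- The values lie in an interval of length `1`; `a` is the midpoint of the one starting at the
infimum. -/
theorem exists_abs_sub_le_half {X : Type*} [Nonempty X] {h : X → ℝ}
    (hh : ∀ x y, |h x - h y| ≤ 1) : ∃ a, ∀ x, |h x - a| ≤ 1 / 2 := by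
  obtain ⟨x₀⟩ := ‹Nonempty X›
  have hbdd : BddBelow (Set.range h) :=
    ⟨h x₀ - 1, by rintro _ ⟨x, rfl⟩; linarith [(abs_le.mp (hh x₀ x)).2]⟩
  refine ⟨sInf (Set.range h) + 1 / 2, fun x => ?_⟩
  have h1 : sInf (Set.range h) ≤ h x := csInf_le hbdd ⟨x, rfl⟩
  have h2 : h x - 1 ≤ sInf (Set.range h) := by
    refine le_csInf ⟨_, x₀, rfl⟩ ?_
    rintro _ ⟨y, rfl⟩
    linarith [(abs_le.mp (hh x y)).2]
  rw [abs_le]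
  constructor <;> linarith

theorem MeasureTheory.Measure.pi_const_smul {k : ℕ} (μ : Measure E) [IsFiniteMeasure μ]
    (r : ℝ≥0) : Measure.pi (fun _ : Fin k => r • μ) = r ^ k • Measure.pi fun _ : Fin k => μ := by
  refine Measure.pi_eq fun s _ => ?_
  rw [Measure.smul_apply, Measure.pi_pi]
  simp only [Measure.smul_apply, ENNReal.smul_def, smul_eq_mul, Finset.prod_mul_distrib,
    Finset.prod_const, Finset.card_univ, Fintype.card_fin, ENNReal.coe_pow]

/-- The integral against a Poisson law is a Poisson average over product measures. -/
theorem hasSum_integral_poissonLaw_smul (μ : Measure E) [IsProbabilityMeasure μ] (r : ℝ≥0)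
    {h : PointMeasure E → ℝ} (hh : Integrable h (poissonLaw (r • μ))) :
    HasSum (fun k : ℕ => poissonWeight r k *
      ∫ z, h (PointMeasure.ofFun z) ∂(Measure.pi fun _ : Fin k => μ))
      (∫ ξ, h ξ ∂(poissonLaw (r • μ))) := by
  refine (hasSum_integral_poissonLaw _ hh).congr_fun fun k => ?_
  have hr : (r • μ).real Set.univ = r := by simp
  rw [hr, Measure.pi_const_smul, integral_smul_nnreal_measure, poissonWeight, smul_eq_mul,
    NNReal.smul_def, smul_eq_mul, NNReal.coe_pow, mul_assoc]

variable [MeasurableEq E] {d₀ : E → E → ℝ}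

/-- The first term pays for moving points at a fixed count, the second for changing the Poisson
count. Normalising `Λ'` requires its mass to be positive. -/
theorem abs_integral_poissonLaw_sub_le_of_le (hnn : ∀ x y, 0 ≤ d₀ x y) (hle : ∀ x y, d₀ x y ≤ 1)
    (hdiag : ∀ x, d₀ x x = 0) (Λ Λ' : Measure E) [IsFiniteMeasure Λ] [IsFiniteMeasure Λ']
    {h : PointMeasure E → ℝ} (hh : Measurable h)
    (hlip : ∀ ξ₁ ξ₂ : PointMeasure E, |h ξ₁ - h ξ₂| ≤ d1 d₀ ξ₁.1 ξ₂.1)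
    (hpos : 0 < Λ'.real Set.univ) (hmass : Λ'.real Set.univ ≤ Λ.real Set.univ) :
    |∫ ξ, h ξ ∂(poissonLaw Λ) - ∫ ξ, h ξ ∂(poissonLaw Λ')| ≤
      (Λ - Λ').real Set.univ / Λ.real Set.univ + (√(Λ.real Set.univ) - √(Λ'.real Set.univ)) := by
  have : Nonempty (PointMeasure E) := ⟨PointMeasure.ofFun (Fin.elim0 : Fin 0 → E)⟩
  obtain ⟨a, ha⟩ := exists_abs_sub_le_half fun ξ₁ ξ₂ =>
    (hlip ξ₁ ξ₂).trans (d1_le_one hnn hle ξ₁ ξ₂)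
  have hint : ∀ (P : Measure (PointMeasure E)) [IsFiniteMeasure P],
      Integrable (fun ξ => h ξ - a) P := fun P _ =>
    Integrable.of_bound (C := 1 / 2) (hh.sub_const a).aestronglyMeasurable (ae_of_all _ ha)
  have hshift : ∀ (P : Measure (PointMeasure E)) [IsProbabilityMeasure P],
      ∫ ξ, h ξ ∂P = ∫ ξ, (h ξ - a) ∂P + a := fun P _ => by
    have h1 := integral_add (hint P) (integrable_const a)
    simpa using h1
  rw [hshift, hshift, add_sub_add_right_eq_sub]
  obtain ⟨c, hc, hc'⟩ := Measure.exists_common_part Λ Λ'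
  have hcΛ : c ≤ Λ := hc ▸ Measure.le_add_right le_rfl
  have hcΛ' : c ≤ Λ' := hc' ▸ Measure.le_add_right le_rfl
  have hM := hpos.trans_le hmass
  obtain ⟨M, hMeq⟩ : ∃ M : ℝ≥0, (M : ℝ) = Λ.real Set.univ := ⟨⟨_, measureReal_nonneg⟩, rfl⟩
  obtain ⟨m, hmeq⟩ : ∃ m : ℝ≥0, (m : ℝ) = Λ'.real Set.univ := ⟨⟨_, measureReal_nonneg⟩, rfl⟩
  have hM0 : M ≠ 0 := by rintro rfl; simp [← hMeq] at hM
  have hm0 : m ≠ 0 := by rintro rfl; simp [← hmeq] at hpos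
  have hmM : m ≤ M := by rw [← NNReal.coe_le_coe, hMeq, hmeq]; exact hmass
  have hprob : ∀ (μ : Measure E) [IsFiniteMeasure μ] (r : ℝ≥0), (r : ℝ) = μ.real Set.univ →
      r ≠ 0 → IsProbabilityMeasure (r⁻¹ • μ) := fun μ _ r hr hr0 => by
    refine ⟨?_⟩
    have : μ Set.univ = r := by
      rw [← ENNReal.ofReal_coe_nnreal, hr, measureReal_def,
        ENNReal.ofReal_toReal (measure_ne_top _ _)]
    rw [Measure.smul_apply, this, ENNReal.smul_def, smul_eq_mul, ← ENNReal.coe_mul,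
      inv_mul_cancel₀ hr0, ENNReal.coe_one]
  have p1 := hprob Λ M hMeq hM0
  have p2 := hprob Λ' m hmeq hm0
  have s1 : M • (M⁻¹ • Λ) = Λ := by rw [smul_smul, mul_inv_cancel₀ hM0, one_smul]
  have s2 : m • (m⁻¹ • Λ') = Λ' := by rw [smul_smul, mul_inv_cancel₀ hm0, one_smul]
  have hc1 : M⁻¹ • c ≤ M⁻¹ • Λ := Measure.le_iff.mpr fun s _ => by
    simp only [Measure.smul_apply, ENNReal.smul_def, smul_eq_mul]
    gcongr
  -- Since `m ≤ M`, scaling `c` by the smaller factor `M⁻¹` keeps it below both normalised measures.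
  have hc2 : M⁻¹ • c ≤ m⁻¹ • Λ' := Measure.le_iff.mpr fun s _ => by
    simp only [Measure.smul_apply, ENNReal.smul_def, smul_eq_mul]
    gcongr
  have hgm : ∀ k : ℕ, Measurable fun z : Fin k → E => h (PointMeasure.ofFun z) - a := fun k =>
    (hh.comp (PointMeasure.measurable_ofFun k)).sub_const a
  have hab : ∀ k : ℕ,
      |∫ z, (h (PointMeasure.ofFun z) - a) ∂(Measure.pi fun _ : Fin k => M⁻¹ • Λ) -
        ∫ z, (h (PointMeasure.ofFun z) - a) ∂(Measure.pi fun _ : Fin k => m⁻¹ • Λ')| ≤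
      1 - (M⁻¹ • c).real Set.univ := fun k => by
    refine abs_integral_pi_sub_integral_pi_le hc1 hc2 (hgm k) (fun z => ha _) fun x y => ?_
    rw [sub_sub_sub_cancel_right]
    refine (hlip _ _).trans ((d1_ofFun_le hnn x y).trans ?_)
    gcongr with i
    by_cases hxy : x i = y i
    · simp [hxy, hdiag]
    · simpa [hxy] using hle (x i) (y i)
  have hb : ∀ k : ℕ,
      |∫ z, (h (PointMeasure.ofFun z) - a) ∂(Measure.pi fun _ : Fin k => m⁻¹ • Λ')| ≤ 1 / 2 :=
    fun k => by
      have := norm_integral_le_of_norm_le_const (μ := Measure.pi fun _ : Fin k => m⁻¹ • Λ')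
        (f := fun z => h (PointMeasure.ofFun z) - a) (C := 1 / 2) (ae_of_all _ fun z => ha _)
      simpa using this
  have key := abs_tsum_poissonWeight_sub_le m.2 (NNReal.coe_le_coe.mpr hmM) hab hb
    (hasSum_integral_poissonLaw_smul (M⁻¹ • Λ) M (h := fun ξ => h ξ - a)
      (by rw [s1]; exact hint _))
    (hasSum_integral_poissonLaw_smul (m⁻¹ • Λ') m (h := fun ξ => h ξ - a)
      (by rw [s2]; exact hint _))
  rw [s1, s2] at key
  have e1 : Λ.real Set.univ = c.real Set.univ + (Λ - Λ').real Set.univ := by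
    have := isFiniteMeasure_of_le Λ hcΛ
    rw [← measureReal_add_apply, hc]
  have e2 : 1 - (M⁻¹ • c).real Set.univ = (Λ - Λ').real Set.univ / Λ.real Set.univ := by
    rw [measureReal_nnreal_smul_apply, NNReal.coe_inv, hMeq]
    field_simp
    linarith
  rw [e2] at key
  change _ ≤ _ + (√(M : ℝ) - √(m : ℝ)) at key
  rwa [hMeq, hmeq] at key

theorem abs_integral_poissonLaw_sub_le_stein_of_le (hnn : ∀ x y, 0 ≤ d₀ x y)
    (hle : ∀ x y, d₀ x y ≤ 1)
    (hdiag : ∀ x, d₀ x x = 0) (Λ Λ' : Measure E) [IsFiniteMeasure Λ] [IsFiniteMeasure Λ']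
    {h : PointMeasure E → ℝ} (hh : Measurable h)
    (hlip : ∀ ξ₁ ξ₂ : PointMeasure E, |h ξ₁ - h ξ₂| ≤ d1 d₀ ξ₁.1 ξ₂.1)
    (hbig : 1.65 ^ 2 ≤ Λ.real Set.univ) (hmass : Λ'.real Set.univ ≤ Λ.real Set.univ) :
    |∫ ξ, h ξ ∂(poissonLaw Λ) - ∫ ξ, h ξ ∂(poissonLaw Λ')| ≤
      1.65 / √(Λ.real Set.univ) * (absDiff Λ Λ').real Set.univ := by
  have e : Λ.real Set.univ + (Λ' - Λ).real Set.univ =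
      Λ'.real Set.univ + (Λ - Λ').real Set.univ := by
    rw [← measureReal_add_apply, ← measureReal_add_apply, Measure.add_sub_eq_add_sub]
  have e3 : (absDiff Λ Λ').real Set.univ = (Λ - Λ').real Set.univ + (Λ' - Λ).real Set.univ :=
    measureReal_add_apply ..
  have n1 : 0 ≤ (Λ - Λ').real Set.univ := measureReal_nonneg
  have n2 : 0 ≤ (Λ' - Λ).real Set.univ := measureReal_nonneg
  have n3 : 0 ≤ Λ'.real Set.univ := measureReal_nonneg
  have hroot : 1.65 ≤ √(Λ.real Set.univ) := Real.le_sqrt_of_sq_le hbig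
  have hsq : √(Λ.real Set.univ) ^ 2 = Λ.real Set.univ :=
    Real.sq_sqrt (hbig.trans' (by norm_num))
  rcases n3.eq_or_lt with h0 | hpos
  -- If `Λ' = 0` then `V ≥ Λ(E)`, so the right side is at least `1.65 √Λ(E) ≥ 1`, while the left
  -- side is at most `1`.
  · have : Nonempty (PointMeasure E) := ⟨PointMeasure.ofFun (Fin.elim0 : Fin 0 → E)⟩
    obtain ⟨a, ha⟩ := exists_abs_sub_le_half fun ξ₁ ξ₂ =>
      (hlip ξ₁ ξ₂).trans (d1_le_one hnn hle ξ₁ ξ₂)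
    have h1 := abs_integral_sub_integral_le_of_common_part (P := poissonLaw Λ)
      (Q := poissonLaw Λ') (Measure.zero_le _) (Measure.zero_le _) hh ha
    have h2 : Λ.real Set.univ ≤ (absDiff Λ Λ').real Set.univ := by linarith
    refine h1.trans ?_
    simp only [measureReal_zero, Pi.zero_apply, sub_zero]
    calc (1 : ℝ) ≤ 1.65 / √(Λ.real Set.univ) * Λ.real Set.univ := by
          rw [← hsq, Real.sqrt_sq (by positivity)]
          field_simp
          linarith
      _ ≤ _ := by gcongr
  · refine (abs_integral_poissonLaw_sub_le_of_le hnn hle hdiag Λ Λ' hh hlip hpos hmass).trans ?_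
    set V := (absDiff Λ Λ').real Set.univ
    set r := √(Λ.real Set.univ)
    have hr : 0 < r := by linarith
    have hV : 0 ≤ V := by linarith
    -- The constant `1.65 = 0.65 + 1` arises here: `1/r ≤ 1/1.65 < 0.65` when `r ≥ 1.65`.
    have i1 : (Λ - Λ').real Set.univ / Λ.real Set.univ ≤ V / r * 0.65 := by
      rw [← hsq]
      calc (Λ - Λ').real Set.univ / r ^ 2 ≤ V / r ^ 2 := by gcongr; linarith
        _ = V / r * (1 / r) := by ring
        _ ≤ V / r * 0.65 := by
          gcongr
          rw [div_le_iff₀ hr]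
          linarith
    -- With `m` the mass of `Λ'`, `r (r - √m) ≤ r² - m ≤ V`, since `√m ≤ r`.
    have i2 : r - √(Λ'.real Set.univ) ≤ V / r := by
      rw [le_div_iff₀ hr]
      have h1 := Real.sq_sqrt n3
      have h2 : √(Λ'.real Set.univ) ≤ r := Real.sqrt_le_sqrt hmass
      have h3 := Real.sqrt_nonneg (Λ'.real Set.univ)
      nlinarith
    calc _ ≤ V / r * 0.65 + V / r := add_le_add i1 i2
      _ = 1.65 / r * V := by ring

/-- If `Λ'` is the heavier measure, exchanging the roles gives the factor with the larger mass,
which is even smaller. -/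
theorem abs_integral_poissonLaw_sub_le_stein (hnn : ∀ x y, 0 ≤ d₀ x y)
    (hle : ∀ x y, d₀ x y ≤ 1)
    (hdiag : ∀ x, d₀ x x = 0) (Λ Λ' : Measure E) [IsFiniteMeasure Λ] [IsFiniteMeasure Λ']
    {h : PointMeasure E → ℝ} (hh : Measurable h)
    (hlip : ∀ ξ₁ ξ₂ : PointMeasure E, |h ξ₁ - h ξ₂| ≤ d1 d₀ ξ₁.1 ξ₂.1)
    (hbig : 1.65 ^ 2 ≤ Λ.real Set.univ) :
    |∫ ξ, h ξ ∂(poissonLaw Λ) - ∫ ξ, h ξ ∂(poissonLaw Λ')| ≤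
      1.65 / √(Λ.real Set.univ) * (absDiff Λ Λ').real Set.univ := by
  rcases le_total (Λ'.real Set.univ) (Λ.real Set.univ) with hm | hm
  · exact abs_integral_poissonLaw_sub_le_stein_of_le hnn hle hdiag Λ Λ' hh hlip hbig hm
  · have h1 := abs_integral_poissonLaw_sub_le_stein_of_le hnn hle hdiag Λ' Λ hh hlip
      (hbig.trans hm) hm
    rw [abs_sub_comm, absDiff_comm]
    refine h1.trans ?_
    have : 0 < √(Λ.real Set.univ) := Real.sqrt_pos.mpr (hbig.trans_lt' (by norm_num))
    gcongr

/-- For mass at most `1.65²` the minimum is `1` and the total variation estimate suffices; this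
includes mass `0`, whose power is `⊤`. -/
theorem ofReal_abs_integral_poissonLaw_sub_le_stein (hnn : ∀ x y, 0 ≤ d₀ x y)
    (hle : ∀ x y, d₀ x y ≤ 1)
    (hdiag : ∀ x, d₀ x x = 0) (Λ Λ' : Measure E) [IsFiniteMeasure Λ] [IsFiniteMeasure Λ']
    {h : PointMeasure E → ℝ} (hh : Measurable h)
    (hlip : ∀ ξ₁ ξ₂ : PointMeasure E, |h ξ₁ - h ξ₂| ≤ d1 d₀ ξ₁.1 ξ₂.1) :
    ENNReal.ofReal |∫ ξ, h ξ ∂(poissonLaw Λ) - ∫ ξ, h ξ ∂(poissonLaw Λ')| ≤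
      min 1 (ENNReal.ofReal 1.65 * Λ Set.univ ^ (-(1 / 2) : ℝ)) * absDiff Λ Λ' Set.univ := by
  have : Nonempty (PointMeasure E) := ⟨PointMeasure.ofFun (Fin.elim0 : Fin 0 → E)⟩
  obtain ⟨a, ha⟩ := exists_abs_sub_le_half fun ξ₁ ξ₂ =>
    (hlip ξ₁ ξ₂).trans (d1_le_one hnn hle ξ₁ ξ₂)
  have h1 : ENNReal.ofReal |∫ ξ, h ξ ∂(poissonLaw Λ) - ∫ ξ, h ξ ∂(poissonLaw Λ')| ≤
      absDiff Λ Λ' Set.univ :=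
    ENNReal.ofReal_le_of_le_toReal (abs_integral_poissonLaw_sub_le Λ Λ' hh ha)
  have hΛ : Λ Set.univ = ENNReal.ofReal (Λ.real Set.univ) :=
    (ENNReal.ofReal_toReal (measure_ne_top _ _)).symm
  rcases le_total (1.65 ^ 2) (Λ.real Set.univ) with hbig | hsmall
  · have hpos : 0 < Λ.real Set.univ := hbig.trans_lt' (by norm_num)
    have h2 : ENNReal.ofReal |∫ ξ, h ξ ∂(poissonLaw Λ) - ∫ ξ, h ξ ∂(poissonLaw Λ')| ≤
        ENNReal.ofReal 1.65 * Λ Set.univ ^ (-(1 / 2) : ℝ) * absDiff Λ Λ' Set.univ := by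
      have h3 := ENNReal.ofReal_le_ofReal
        (abs_integral_poissonLaw_sub_le_stein hnn hle hdiag Λ Λ' hh hlip hbig)
      refine h3.trans_eq ?_
      have h5 : (0 : ℝ) ≤ 1.65 := by norm_num
      rw [ENNReal.ofReal_mul (div_nonneg h5 (Real.sqrt_nonneg _)), hΛ,
        ENNReal.ofReal_rpow_of_pos hpos, Real.rpow_neg hpos.le, ← Real.sqrt_eq_rpow,
        div_eq_mul_inv, ENNReal.ofReal_mul h5, measureReal_def (absDiff Λ Λ'),
        ENNReal.ofReal_toReal (measure_ne_top _ _)]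
    rcases min_choice 1 (ENNReal.ofReal 1.65 * Λ Set.univ ^ (-(1 / 2) : ℝ)) with hc | hc
    · rw [hc, one_mul]; exact h1
    · rw [hc]; exact h2
  · rw [min_eq_left, one_mul]
    · exact h1
    · have h4 : Λ Set.univ ≤ ENNReal.ofReal 1.65 ^ (2 : ℝ) := by
        rw [hΛ, ENNReal.ofReal_rpow_of_pos (by norm_num)]
        exact ENNReal.ofReal_le_ofReal (by exact_mod_cast hsmall)
      calc (1 : ℝ≥0∞) = ENNReal.ofReal 1.65 * (ENNReal.ofReal 1.65 ^ (2 : ℝ)) ^ (-(1 / 2) : ℝ) := by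
            rw [← ENNReal.rpow_mul]
            norm_num
            rw [ENNReal.rpow_neg_one, ENNReal.mul_inv_cancel (by norm_num) (by simp)]
        _ ≤ _ := by
            refine mul_le_mul_right ?_ _
            rw [ENNReal.rpow_neg, ENNReal.rpow_neg, ENNReal.inv_le_inv]
            exact ENNReal.rpow_le_rpow h4 (by norm_num)

theorem d2_poissonLaw_le (hnn : ∀ x y, 0 ≤ d₀ x y) (hle : ∀ x y, d₀ x y ≤ 1)
    (hdiag : ∀ x, d₀ x x = 0) (Λ Λ' : Measure E) [IsFiniteMeasure Λ] [IsFiniteMeasure Λ'] :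
    d2 d₀ (poissonLaw Λ) (poissonLaw Λ') ≤
      steinFactor (Λ Set.univ) (Λ' Set.univ) * absDiff Λ Λ' Set.univ := by
  refine iSup_le fun h => iSup₂_le fun hh hlip => ?_
  have h1 := ofReal_abs_integral_poissonLaw_sub_le_stein hnn hle hdiag Λ Λ' hh hlip
  have h2 := ofReal_abs_integral_poissonLaw_sub_le_stein hnn hle hdiag Λ' Λ hh hlip
  rw [abs_sub_comm, absDiff_comm] at h2
  unfold steinFactor
  rcases min_choice (Λ Set.univ ^ (-(1 / 2) : ℝ)) (Λ' Set.univ ^ (-(1 / 2) : ℝ)) with hc | hc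
  · rw [hc]; exact h1
  · rw [hc]; exact h2

end D2

/-! ### Marshall–Olkin exponential intensities -/

section MarshallOlkin

/-- The intensity `b (1 - b) exp (-(1 - b) s - b t)` on `s < t`. -/
def wedgeIntensity (b s t : ℝ) : ℝ :=
  if s < t then b * (1 - b) * Real.exp (-(1 - b) * s) * Real.exp (-b * t) else 0

/-- The off-diagonal Marshall–Olkin intensity with parameters `a` and `b`; both `intensity` and
`limitIntensity` are of this form. -/
def moIntensity (a b s t : ℝ) : ℝ := wedgeIntensity b s t + wedgeIntensity a t s

/-- The Marshall–Olkin intensity on the diagonal. -/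
def moDiagIntensity (a b s : ℝ) : ℝ := (a + b - 1) * Real.exp (-s)

theorem wedgeIntensity_nonneg {b : ℝ} (hb : b ∈ Set.Ioc (0 : ℝ) 1) (s t : ℝ) :
    0 ≤ wedgeIntensity b s t := by
  have h1 := hb.1
  have h2 : 0 ≤ 1 - b := sub_nonneg.mpr hb.2
  unfold wedgeIntensity
  split_ifs <;> positivity

theorem measurable_wedgeIntensity (b : ℝ) :
    Measurable fun z : ℝ × ℝ => wedgeIntensity b z.1 z.2 :=
  Measurable.ite (measurableSet_lt measurable_fst measurable_snd) (by fun_prop) measurable_const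

theorem measurable_moIntensity (a b : ℝ) :
    Measurable fun z : ℝ × ℝ => moIntensity a b z.1 z.2 :=
  (measurable_wedgeIntensity b).add ((measurable_wedgeIntensity a).comp measurable_swap)

theorem measurable_moDiagIntensity (a b : ℝ) : Measurable (moDiagIntensity a b) := by
  unfold moDiagIntensity; fun_prop

theorem lintegral_Ioi_exp_neg_mul {b : ℝ} (hb : 0 < b) (u : ℝ) :
    ∫⁻ t in Set.Ioi u, ENNReal.ofReal (Real.exp (-b * t)) =
      ENNReal.ofReal (Real.exp (-b * u) / b) := by
  rw [← ofReal_integral_eq_lintegral_ofReal (integrableOn_exp_mul_Ioi (neg_lt_zero.mpr hb) u)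
    (ae_of_all _ fun t => Real.exp_nonneg _), integral_exp_mul_Ioi (neg_lt_zero.mpr hb),
    neg_div_neg_eq]

theorem lintegral_Ici_const_mul_exp_neg {c : ℝ} (hc : 0 ≤ c) (u : ℝ) :
    ∫⁻ s in Set.Ici u, ENNReal.ofReal (c * Real.exp (-s)) =
      ENNReal.ofReal (c * Real.exp (-u)) := by
  simp_rw [ENNReal.ofReal_mul hc]
  rw [lintegral_const_mul _ (by fun_prop), ← restrict_Ioi_eq_restrict_Ici]
  have := lintegral_Ioi_exp_neg_mul one_pos u
  simp only [neg_mul, one_mul, div_one] at this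
  rw [this]

theorem lintegral_wedgeIntensity {b : ℝ} (hb : b ∈ Set.Ioc (0 : ℝ) 1) (u : ℝ) :
    ∫⁻ s in Set.Ici u, ∫⁻ t in Set.Ici u, ENNReal.ofReal (wedgeIntensity b s t) =
      ENNReal.ofReal ((1 - b) * Real.exp (-u)) := by
  have h1 := hb.1
  have h2 : 0 ≤ 1 - b := sub_nonneg.mpr hb.2
  rw [← lintegral_Ici_const_mul_exp_neg h2 u]
  refine setLIntegral_congr_fun measurableSet_Ici fun s hs => ?_
  have e1 : ∀ t, ENNReal.ofReal (wedgeIntensity b s t) = (Set.Ioi s).indicator (fun t =>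
      ENNReal.ofReal (b * (1 - b) * Real.exp (-(1 - b) * s)) *
        ENNReal.ofReal (Real.exp (-b * t))) t := fun t => by
    by_cases hst : s < t
    · rw [Set.indicator_of_mem (Set.mem_Ioi.mpr hst), wedgeIntensity, if_pos hst,
        ENNReal.ofReal_mul (by positivity)]
    · rw [Set.indicator_of_notMem (by simpa using hst), wedgeIntensity, if_neg hst,
        ENNReal.ofReal_zero]
  simp only [e1]
  rw [lintegral_indicator measurableSet_Ioi, Measure.restrict_restrict measurableSet_Ioi,
    Set.inter_eq_left.mpr (Set.Ioi_subset_Ici hs),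
    lintegral_const_mul _ (by fun_prop), lintegral_Ioi_exp_neg_mul h1,
    ← ENNReal.ofReal_mul (by positivity)]
  congr 1
  have e2 : Real.exp (-s) = Real.exp (-(1 - b) * s) * Real.exp (-b * s) := by
    rw [← Real.exp_add]; congr 1; ring
  rw [e2]
  field_simp

theorem lintegral_moIntensity {a b : ℝ} (ha : a ∈ Set.Ioc (0 : ℝ) 1)
    (hb : b ∈ Set.Ioc (0 : ℝ) 1) (u : ℝ) :
    ∫⁻ z in Set.Ici u ×ˢ Set.Ici u, ENNReal.ofReal (moIntensity a b z.1 z.2) =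
      ENNReal.ofReal ((2 - a - b) * Real.exp (-u)) := by
  have e : ∀ z : ℝ × ℝ, ENNReal.ofReal (moIntensity a b z.1 z.2) =
      ENNReal.ofReal (wedgeIntensity b z.1 z.2) + ENNReal.ofReal (wedgeIntensity a z.2 z.1) :=
    fun z => ENNReal.ofReal_add (wedgeIntensity_nonneg hb _ _) (wedgeIntensity_nonneg ha _ _)
  have m1 := (measurable_wedgeIntensity b).ennreal_ofReal
  have m2 : Measurable fun z : ℝ × ℝ => ENNReal.ofReal (wedgeIntensity a z.2 z.1) :=
    ((measurable_wedgeIntensity a).comp measurable_swap).ennreal_ofReal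
  simp_rw [e]
  rw [lintegral_add_left m1, Measure.volume_eq_prod, setLIntegral_prod _ m1.aemeasurable,
    setLIntegral_prod_symm _ m2.aemeasurable]
  rw [lintegral_wedgeIntensity hb, lintegral_wedgeIntensity ha, ← ENNReal.ofReal_add]
  · congr 1; ring
  · exact mul_nonneg (sub_nonneg.mpr hb.2) (Real.exp_nonneg _)
  · exact mul_nonneg (sub_nonneg.mpr ha.2) (Real.exp_nonneg _)

end MarshallOlkin

/-! ### Intensity measures on the state space -/

section IntensityMeasure

variable {n : ℕ}

theorem measurableSet_stateSpace (n : ℕ) :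
    MeasurableSet {z : ℝ × ℝ | -Real.log n ≤ z.1 ∧ -Real.log n ≤ z.2} :=
  (measurableSet_le measurable_const measurable_fst).inter
    (measurableSet_le measurable_const measurable_snd)

theorem intensityMeasure_apply (f : ℝ → ℝ → ℝ) (g : ℝ → ℝ) (A : Set (StateSpace n))
    {B : Set (StateSpace n)} (hA : MeasurableSet A) (hB : MeasurableSet B) :
    intensityMeasure f g A B =
      (∫⁻ z in Subtype.val '' (B ∩ A), ENNReal.ofReal (f z.1 z.2)) +
      ∫⁻ s in (fun s : ℝ => (s, s)) ⁻¹' (Subtype.val '' (B ∩ A)), ENNReal.ofReal (g s) := by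
  have hemb : MeasurableEmbedding (Subtype.val : StateSpace n → ℝ × ℝ) :=
    MeasurableEmbedding.subtype_coe (measurableSet_stateSpace n)
  have hm : MeasurableSet (Subtype.val '' (B ∩ A)) := hemb.measurableSet_image.mpr (hB.inter hA)
  have hd : Measurable fun s : ℝ => (s, s) := measurable_id.prodMk measurable_id
  rw [intensityMeasure, Measure.restrict_apply hB, hemb.comap_apply, Measure.add_apply,
    withDensity_apply _ hm, Measure.map_apply hd hm,
    withDensity_apply _ (hd hm)]

theorem intensityMeasure_eq_restrict (f : ℝ → ℝ → ℝ) (g : ℝ → ℝ) (A : Set (StateSpace n)) :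
    intensityMeasure f g A = (intensityMeasure f g Set.univ).restrict A := by
  simp only [intensityMeasure, Measure.restrict_univ]

theorem measurableSet_jointExceedance (n : ℕ) (u : ℝ) : MeasurableSet (jointExceedance n u) := by
  have h : Measurable fun z : StateSpace n => (z.1.1, z.1.2) := by fun_prop
  exact (measurableSet_le measurable_const h.fst).inter (measurableSet_le measurable_const h.snd)

theorem intensityMeasure_jointExceedance (f : ℝ → ℝ → ℝ) (g : ℝ → ℝ) {u : ℝ}
    (hu : -Real.log n ≤ u) :
    intensityMeasure f g (jointExceedance n u) (jointExceedance n u) =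
      (∫⁻ z in Set.Ici u ×ˢ Set.Ici u, ENNReal.ofReal (f z.1 z.2)) +
      ∫⁻ s in Set.Ici u, ENNReal.ofReal (g s) := by
  have hA := measurableSet_jointExceedance n u
  have e1 : Subtype.val '' (jointExceedance n u ∩ jointExceedance n u) =
      Set.Ici u ×ˢ Set.Ici u := by
    ext z
    simp only [Set.inter_self, jointExceedance, Set.mem_image, Set.mem_ofPred_eq, Subtype.exists,
      exists_and_left, exists_prop, Set.mem_prod, Set.mem_Ici]
    constructor
    · rintro ⟨w, hw, _, rfl⟩
      exact hw
    · exact fun hz => ⟨z, hz, ⟨hu.trans hz.1, hu.trans hz.2⟩, rfl⟩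
  have e2 : (fun s : ℝ => (s, s)) ⁻¹' (Set.Ici u ×ˢ Set.Ici u) = Set.Ici u := by
    ext s; simp
  rw [intensityMeasure_apply f g _ hA hA, e1, e2]

theorem intensityMeasure_le_add {f f₁ f₂ : ℝ → ℝ → ℝ} {g g₁ g₂ : ℝ → ℝ}
    {A : Set (StateSpace n)} (hA : MeasurableSet A)
    (hf₁ : Measurable fun z : ℝ × ℝ => f₁ z.1 z.2) (hg₁ : Measurable g₁)
    (hf : ∀ s t, f s t ≤ f₁ s t + f₂ s t) (hg : ∀ s, g s ≤ g₁ s + g₂ s) :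
    intensityMeasure f g A ≤ intensityMeasure f₁ g₁ A + intensityMeasure f₂ g₂ A := by
  refine Measure.le_iff.mpr fun B hB => ?_
  rw [Measure.add_apply, intensityMeasure_apply _ _ _ hA hB, intensityMeasure_apply _ _ _ hA hB,
    intensityMeasure_apply _ _ _ hA hB, add_add_add_comm,
    ← lintegral_add_left hf₁.ennreal_ofReal, ← lintegral_add_left hg₁.ennreal_ofReal]
  refine add_le_add (lintegral_mono fun z => ?_) (lintegral_mono fun s => ?_)
  · exact (ENNReal.ofReal_le_ofReal (hf _ _)).trans ENNReal.ofReal_add_le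
  · exact (ENNReal.ofReal_le_ofReal (hg _)).trans ENNReal.ofReal_add_le

/-- The two wedges and the diagonal contribute `(1-b) + (1-a) + (a+b-1) = 1` times `exp(-u)`. That
the mass does not depend on `a`, `b` is what makes the later comparison one-sided. -/
theorem intensityMeasure_moIntensity_jointExceedance {a b : ℝ} (ha : a ∈ Set.Ioc (0 : ℝ) 1)
    (hb : b ∈ Set.Ioc (0 : ℝ) 1) (hab : 1 ≤ a + b) {u : ℝ} (hu : -Real.log n ≤ u) :
    intensityMeasure (moIntensity a b) (moDiagIntensity a b) (jointExceedance n u)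
      (jointExceedance n u) = ENNReal.ofReal (Real.exp (-u)) := by
  have h1 : 0 ≤ 2 - a - b := by linarith [ha.2, hb.2]
  have h2 : 0 ≤ a + b - 1 := by linarith
  rw [intensityMeasure_jointExceedance _ _ hu, lintegral_moIntensity ha hb]
  unfold moDiagIntensity
  rw [lintegral_Ici_const_mul_exp_neg h2, ← ENNReal.ofReal_add (by positivity) (by positivity)]
  congr 1
  ring

theorem isFiniteMeasure_intensityMeasure_moIntensity {a b : ℝ} (ha : a ∈ Set.Ioc (0 : ℝ) 1)
    (hb : b ∈ Set.Ioc (0 : ℝ) 1) (hab : 1 ≤ a + b) (A : Set (StateSpace n)) :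
    IsFiniteMeasure (intensityMeasure (moIntensity a b) (moDiagIntensity a b) A) := by
  have huniv : jointExceedance n (-Real.log n) = Set.univ :=
    Set.eq_univ_of_forall fun z => z.2
  have h := intensityMeasure_moIntensity_jointExceedance (n := n) ha hb hab le_rfl
  rw [huniv] at h
  have : IsFiniteMeasure
      (intensityMeasure (n := n) (moIntensity a b) (moDiagIntensity a b) Set.univ) :=
    ⟨by rw [h]; exact ENNReal.ofReal_lt_top⟩
  rw [intensityMeasure_eq_restrict]
  infer_instance

theorem intensityMeasure_apply_self (f : ℝ → ℝ → ℝ) (g : ℝ → ℝ) (A : Set (StateSpace n)) :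
    intensityMeasure f g A A = intensityMeasure f g A Set.univ := by
  rw [intensityMeasure_eq_restrict, Measure.restrict_apply_self, Measure.restrict_apply_univ]

theorem absDiff_intensityMeasure_apply_self (f f' : ℝ → ℝ → ℝ) (g g' : ℝ → ℝ)
    {A : Set (StateSpace n)} (hA : MeasurableSet A) :
    absDiff (intensityMeasure f g A) (intensityMeasure f' g' A) A =
      absDiff (intensityMeasure f g A) (intensityMeasure f' g' A) Set.univ := by
  have h0 : ∀ (f : ℝ → ℝ → ℝ) (g : ℝ → ℝ), intensityMeasure f g A Aᶜ = 0 := fun f g => by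
    rw [intensityMeasure_eq_restrict, Measure.restrict_apply hA.compl]
    simp
  have h1 : absDiff (intensityMeasure f g A) (intensityMeasure f' g' A) Aᶜ = 0 := by
    rw [absDiff, Measure.add_apply, add_eq_zero]
    exact ⟨nonpos_iff_eq_zero.mp ((Measure.sub_le _).trans_eq (h0 f g)),
      nonpos_iff_eq_zero.mp ((Measure.sub_le _).trans_eq (h0 f' g'))⟩
  rw [← measure_add_measure_compl hA, h1, add_zero]

end IntensityMeasure

/-! ### Comparison of Marshall–Olkin intensities -/

section Comparison

/-- For `s < t` the intensity is `c(1-c) exp(-s) exp(-c(t-s))`. Lowering `c` from `β` to `b`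
increases the exponential, and the prefactor keeps at least the fraction `1 - x`. -/
theorem wedgeIntensity_le {b β x : ℝ} (hb : b ∈ Set.Ioc (0 : ℝ) 1) (hβ : β ∈ Set.Ioc (0 : ℝ) 1)
    (hle : b ≤ β) (hge : (1 - x) * β ≤ b) (s t : ℝ) :
    wedgeIntensity β s t ≤ wedgeIntensity b s t + x * wedgeIntensity β s t := by
  unfold wedgeIntensity
  split_ifs with hst
  · have e : ∀ c : ℝ, c * (1 - c) * Real.exp (-(1 - c) * s) * Real.exp (-c * t) =
        c * (1 - c) * (Real.exp (-s) * Real.exp (-c * (t - s))) := fun c => by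
      rw [mul_assoc, ← Real.exp_add, ← Real.exp_add]; congr 2; ring
    rw [e, e]
    have h1 : Real.exp (-β * (t - s)) ≤ Real.exp (-b * (t - s)) :=
      Real.exp_le_exp.mpr (by nlinarith)
    have h2 : (1 - x) * β * (1 - β) ≤ b * (1 - b) := by
      have h3 : 0 ≤ 1 - β := sub_nonneg.mpr hβ.2
      calc (1 - x) * β * (1 - β) ≤ b * (1 - β) := by gcongr
        _ ≤ b * (1 - b) := by have := hb.1.le; gcongr
    have h4 : 0 ≤ b * (1 - b) := mul_nonneg hb.1.le (sub_nonneg.mpr hb.2)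
    have h5 : (1 - x) * β * (1 - β) * (Real.exp (-s) * Real.exp (-β * (t - s))) ≤
        b * (1 - b) * (Real.exp (-s) * Real.exp (-b * (t - s))) := by
      calc _ ≤ b * (1 - b) * (Real.exp (-s) * Real.exp (-β * (t - s))) := by gcongr
        _ ≤ _ := by gcongr
    linarith
  · simp

/-- The upper bound is Bernoulli's inequality `(1-x)^α ≤ 1 - αx`. The lower one combines `-log(1-αx)
≥ αx` with `-log(1-x) ≤ x/(1-x)`. -/
theorem log_ratio_bounds {x α : ℝ} (hx : 0 < x) (hx1 : x < 1) (hα : 0 < α) (hα1 : α ≤ 1) :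
    (1 - x) * α ≤ Real.log (1 - α * x) / Real.log (1 - x) ∧
      Real.log (1 - α * x) / Real.log (1 - x) ≤ α := by
  have hy : 0 < 1 - x := by linarith
  have hαx : 0 < 1 - α * x := by nlinarith
  have hL : Real.log (1 - x) < 0 := Real.log_neg hy (by linarith)
  constructor
  · rw [le_div_iff_of_neg hL]
    have h1 := Real.log_le_sub_one_of_pos hαx
    have h2 := Real.one_sub_inv_le_log_of_pos hy
    have h3 : (1 - x) * (1 - (1 - x)⁻¹) = -x := by field_simp; ring
    have h4 := mul_le_mul_of_nonneg_left h2 (mul_pos hy hα).le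
    nlinarith
  · rw [div_le_iff_of_neg hL, ← Real.log_rpow hy]
    refine Real.log_le_log (Real.rpow_pos_of_pos hy α) ?_
    have := rpow_one_add_le_one_add_mul_self (s := -x) (by linarith) hα.le hα1
    calc (1 - x) ^ α = (1 + -x) ^ α := by rw [← sub_eq_add_neg]
      _ ≤ 1 + α * -x := this
      _ = 1 - α * x := by ring

variable {n : ℕ}

/-- The variation of the difference of two Marshall–Olkin mean measures on `[u, ∞)²`. -/
theorem absDiff_moIntensity_le {a b α β x θ u : ℝ} (ha : a ∈ Set.Ioc (0 : ℝ) 1)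
    (hb : b ∈ Set.Ioc (0 : ℝ) 1) (hab : 1 ≤ a + b) (hα : α ∈ Set.Ioc (0 : ℝ) 1)
    (hβ : β ∈ Set.Ioc (0 : ℝ) 1) (hx : 0 ≤ x) (hθ : 0 < θ) (hαβ : α + β - 1 = 1 / θ)
    (haα : a ≤ α) (haα' : (1 - x) * α ≤ a) (hbβ : b ≤ β) (hbβ' : (1 - x) * β ≤ b)
    (hu : -Real.log n ≤ u) :
    absDiff (intensityMeasure (moIntensity a b) (moDiagIntensity a b) (jointExceedance n u))
      (intensityMeasure (moIntensity α β) (moDiagIntensity α β) (jointExceedance n u))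
      (jointExceedance n u) ≤ ENNReal.ofReal (4 * x * Real.exp (-u)) := by
  set A := jointExceedance n u
  have hA : MeasurableSet A := measurableSet_jointExceedance n u
  have hθ' : 0 < 1 / θ := by positivity
  have hαβ1 : 1 ≤ α + β := by linarith
  have hfin := isFiniteMeasure_intensityMeasure_moIntensity ha hb hab A
  have hfin' := isFiniteMeasure_intensityMeasure_moIntensity hα hβ hαβ1 A
  have hm := intensityMeasure_moIntensity_jointExceedance ha hb hab hu
  have hm' := intensityMeasure_moIntensity_jointExceedance hα hβ hαβ1 hu
  set Λ := intensityMeasure (moIntensity a b) (moDiagIntensity a b) A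
  set Λ' := intensityMeasure (moIntensity α β) (moDiagIntensity α β) A
  -- On the diagonal the deficit is at most `x(α+β)`, which equals `x(1+θ)(α+β-1)` because `α+β-1 =
  -- 1/θ`. The mass of `τ` is then `x(2-α-β) + x(α+β) = 2x` times `exp(-u)`.
  let τ := intensityMeasure (fun s t => x * moIntensity α β s t)
    (fun s => x * (1 + θ) * moDiagIntensity α β s) A
  have hle : Λ' ≤ τ + Λ := by
    rw [add_comm]
    refine intensityMeasure_le_add hA (measurable_moIntensity a b) (measurable_moDiagIntensity a b)
      (fun s t => ?_) fun s => ?_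
    · unfold moIntensity
      linarith [wedgeIntensity_le hb hβ hbβ hbβ' s t, wedgeIntensity_le ha hα haα haα' t s]
    · unfold moDiagIntensity
      rw [← mul_assoc, ← add_mul]
      refine mul_le_mul_of_nonneg_right ?_ (Real.exp_nonneg _)
      have h1 : x * (1 + θ) * (α + β - 1) = x * (α + β) := by
        rw [hαβ, show α + β = 1 + 1 / θ by linarith]; field_simp; ring
      rw [h1]
      linarith
  have hτ : τ A = ENNReal.ofReal (2 * x * Real.exp (-u)) := by
    have h2 : 0 ≤ 2 - α - β := by linarith [hα.2, hβ.2]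
    have h3 : 0 ≤ x * (1 + θ) * (α + β - 1) := by rw [hαβ]; positivity
    have e1 : ∀ z : ℝ × ℝ, ENNReal.ofReal (x * moIntensity α β z.1 z.2) =
        ENNReal.ofReal x * ENNReal.ofReal (moIntensity α β z.1 z.2) := fun z =>
      ENNReal.ofReal_mul hx
    have e2 : ∀ s, x * (1 + θ) * moDiagIntensity α β s =
        x * (1 + θ) * (α + β - 1) * Real.exp (-s) := fun s => by
      unfold moDiagIntensity; ring
    rw [intensityMeasure_jointExceedance _ _ hu]
    simp_rw [e1, e2]
    rw [lintegral_const_mul _ (measurable_moIntensity α β).ennreal_ofReal,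
      lintegral_moIntensity hα hβ, lintegral_Ici_const_mul_exp_neg h3, ← ENNReal.ofReal_mul hx,
      ← ENNReal.ofReal_add (by positivity) (by positivity)]
    congr 1
    have h1 : x * (1 + θ) * (α + β - 1) = x * (α + β) := by
      rw [hαβ, show α + β = 1 + 1 / θ by linarith]; field_simp; ring
    rw [h1]
    ring
  have hsub : (Λ' - Λ) A ≤ ENNReal.ofReal (2 * x * Real.exp (-u)) :=
    (Measure.sub_le_of_le_add hle A).trans_eq hτ
  -- Equal total masses force the positive and negative parts to have equal mass.
  have hsymm : (Λ - Λ') A = (Λ' - Λ) A := by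
    have h := congrArg (fun m : Measure (StateSpace n) => m A) (Measure.add_sub_eq_add_sub Λ Λ')
    simp only [Measure.add_apply] at h
    rw [hm, hm'] at h
    exact ((ENNReal.add_right_inj ENNReal.ofReal_ne_top).mp h).symm
  rw [absDiff, Measure.add_apply, hsymm]
  calc (Λ' - Λ) A + (Λ' - Λ) A
      ≤ ENNReal.ofReal (2 * x * Real.exp (-u)) + ENNReal.ofReal (2 * x * Real.exp (-u)) :=
        add_le_add hsub hsub
    _ = ENNReal.ofReal (4 * x * Real.exp (-u)) := by
        rw [← ENNReal.ofReal_add (by positivity) (by positivity)]; congr 1; ring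

end Comparison

/-! ### The Marshall–Olkin geometric setting -/

section Setting

variable {n : ℕ}

theorem BernoulliPair.p00_le_q1 (p : BernoulliPair) : p.p00 ≤ p.q1 := by
  unfold BernoulliPair.q1; linarith [p.p01_nonneg]

theorem BernoulliPair.p00_le_q2 (p : BernoulliPair) : p.p00 ≤ p.q2 := by
  unfold BernoulliPair.q2; linarith [p.p10_nonneg]

theorem log_div_log_mem_Ioc {x y : ℝ} (hx : 0 < x) (hxy : x ≤ y) (hy : y < 1) :
    Real.log y / Real.log x ∈ Set.Ioc (0 : ℝ) 1 := by
  have h1 : Real.log x < 0 := Real.log_neg hx (hxy.trans_lt hy)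
  have h2 : Real.log y < 0 := Real.log_neg (hx.trans_le hxy) hy
  exact ⟨div_pos_of_neg_of_neg h2 h1, (div_le_one_of_neg h1).mpr (Real.log_le_log hx hxy)⟩

/-- This is where `p00 ≥ q1 q2` enters: it makes the diagonal intensity nonnegative. -/
theorem BernoulliPair.one_le_add_log_ratio (p : BernoulliPair) (hp00 : 0 < p.p00)
    (hq1 : p.q1 < 1) (hq : p.q1 * p.q2 ≤ p.p00) :
    1 ≤ Real.log p.q1 / Real.log p.p00 + Real.log p.q2 / Real.log p.p00 := by
  have h1 : 0 < p.q1 := hp00.trans_le p.p00_le_q1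
  have h2 : 0 < p.q2 := hp00.trans_le p.p00_le_q2
  have hL : Real.log p.p00 < 0 := Real.log_neg hp00 (p.p00_le_q1.trans_lt hq1)
  rw [← add_div, one_le_div_of_neg hL, ← Real.log_mul h1.ne' h2.ne']
  exact Real.log_le_log (mul_pos h1 h2) hq

theorem meanMeasure_eq (p : BernoulliPair) (hp00 : 0 < p.p00) (hq1 : p.q1 < 1)
    (A : Set (StateSpace n)) :
    meanMeasure p A = intensityMeasure
      (moIntensity (Real.log p.q1 / Real.log p.p00) (Real.log p.q2 / Real.log p.p00))
      (moDiagIntensity (Real.log p.q1 / Real.log p.p00) (Real.log p.q2 / Real.log p.p00)) A := by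
  have h1 : p.q1 ≠ 0 := (hp00.trans_le p.p00_le_q1).ne'
  have h2 : p.q2 ≠ 0 := (hp00.trans_le p.p00_le_q2).ne'
  have hL : Real.log p.p00 ≠ 0 := (Real.log_neg hp00 (p.p00_le_q1.trans_lt hq1)).ne
  have hi : p.intensity =
      moIntensity (Real.log p.q1 / Real.log p.p00) (Real.log p.q2 / Real.log p.p00) := by
    funext s t
    have e : ∀ q : ℝ, q ≠ 0 → Real.log (p.p00 / q) / Real.log p.p00 =
        1 - Real.log q / Real.log p.p00 := fun q hq => by
      rw [Real.log_div hp00.ne' hq]; field_simp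
    have e' : ∀ q : ℝ, q ≠ 0 →
        Real.log (p.p00 / q) * Real.log q / Real.log (1 / p.p00) ^ 2 =
          Real.log q / Real.log p.p00 * (1 - Real.log q / Real.log p.p00) := fun q hq => by
      rw [Real.log_div hp00.ne' hq, one_div, Real.log_inv]; field_simp
    unfold BernoulliPair.intensity moIntensity wedgeIntensity
    rcases lt_trichotomy s t with hst | rfl | hst
    · rw [if_pos hst, if_pos hst, if_neg hst.not_gt, add_zero, e _ h2, e' _ h2]
    · simp
    · rw [if_neg hst.not_gt, if_pos hst, if_neg hst.not_gt, if_pos hst, zero_add, e _ h1, e' _ h1]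
      ring
  have hd : p.diagIntensity =
      moDiagIntensity (Real.log p.q1 / Real.log p.p00) (Real.log p.q2 / Real.log p.p00) := by
    funext s
    unfold BernoulliPair.diagIntensity moDiagIntensity
    rw [Real.log_div hp00.ne' (mul_ne_zero h1 h2), Real.log_mul h1 h2, one_div, Real.log_inv]
    congr 1
    field_simp
    ring
  rw [meanMeasure, hi, hd]

theorem limitMeasure_eq {γ δ : ℝ} (hγ : 0 < γ) (hδ : 0 < δ) (A : Set (StateSpace n)) :
    limitMeasure γ δ A = intensityMeasure
      (moIntensity ((1 + γ) / (1 + γ + δ)) ((1 + δ) / (1 + γ + δ)))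
      (moDiagIntensity ((1 + γ) / (1 + γ + δ)) ((1 + δ) / (1 + γ + δ))) A := by
  have hθ : 1 + γ + δ ≠ 0 := by positivity
  have eγ : 1 - (1 + γ) / (1 + γ + δ) = δ / (1 + γ + δ) := by field_simp; ring
  have eδ : 1 - (1 + δ) / (1 + γ + δ) = γ / (1 + γ + δ) := by field_simp; ring
  have hi : limitIntensity γ δ =
      moIntensity ((1 + γ) / (1 + γ + δ)) ((1 + δ) / (1 + γ + δ)) := by
    funext s t
    unfold limitIntensity moIntensity wedgeIntensity
    rw [eγ, eδ]
    rcases lt_trichotomy s t with hst | rfl | hst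
    · rw [if_pos hst, if_pos hst, if_neg hst.not_gt, add_zero]
      congr 2
      field_simp
    · simp
    · rw [if_neg hst.not_gt, if_pos hst, if_neg hst.not_gt, if_pos hst, zero_add,
        mul_right_comm]
      congr 2
      field_simp
  have hd : limitDiagIntensity γ δ =
      moDiagIntensity ((1 + γ) / (1 + γ + δ)) ((1 + δ) / (1 + γ + δ)) := by
    funext s
    unfold limitDiagIntensity moDiagIntensity
    congr 1
    field_simp
    ring
  rw [limitMeasure, hi, hd]

theorem div_mem_Ioc {γ δ : ℝ} (hγ : 0 < γ) (hδ : 0 < δ) :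
    (1 + γ) / (1 + γ + δ) ∈ Set.Ioc (0 : ℝ) 1 ∧ (1 + δ) / (1 + γ + δ) ∈ Set.Ioc (0 : ℝ) 1 ∧
      (1 + γ) / (1 + γ + δ) + (1 + δ) / (1 + γ + δ) - 1 = 1 / (1 + γ + δ) := by
  have hθ : 0 < 1 + γ + δ := by positivity
  refine ⟨⟨by positivity, (div_le_one hθ).mpr (by linarith)⟩,
    ⟨by positivity, (div_le_one hθ).mpr (by linarith)⟩, ?_⟩
  field_simp
  ring

theorem isFiniteMeasure_meanMeasure (p : BernoulliPair) (hp00 : 0 < p.p00) (hq1 : p.q1 < 1)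
    (hq2 : p.q2 < 1) (hq : p.q1 * p.q2 ≤ p.p00) (A : Set (StateSpace n)) :
    IsFiniteMeasure (meanMeasure p A) := by
  rw [meanMeasure_eq p hp00 hq1]
  exact isFiniteMeasure_intensityMeasure_moIntensity (log_div_log_mem_Ioc hp00 p.p00_le_q1 hq1)
    (log_div_log_mem_Ioc hp00 p.p00_le_q2 hq2) (p.one_le_add_log_ratio hp00 hq1 hq) A

theorem isFiniteMeasure_limitMeasure {γ δ : ℝ} (hγ : 0 < γ) (hδ : 0 < δ)
    (A : Set (StateSpace n)) : IsFiniteMeasure (limitMeasure γ δ A) := by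
  obtain ⟨h1, h2, h3⟩ := div_mem_Ioc hγ hδ
  have h4 : 0 < 1 / (1 + γ + δ) := by positivity
  rw [limitMeasure_eq hγ hδ]
  exact isFiniteMeasure_intensityMeasure_moIntensity h1 h2 (by linarith) A

theorem meanMeasure_jointExceedance (p : BernoulliPair) (hp00 : 0 < p.p00) (hq1 : p.q1 < 1)
    (hq2 : p.q2 < 1) (hq : p.q1 * p.q2 ≤ p.p00) {u : ℝ} (hu : -Real.log n ≤ u) :
    meanMeasure p (jointExceedance n u) (jointExceedance n u) =
      ENNReal.ofReal (Real.exp (-u)) := by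
  rw [meanMeasure_eq p hp00 hq1]
  exact intensityMeasure_moIntensity_jointExceedance (log_div_log_mem_Ioc hp00 p.p00_le_q1 hq1)
    (log_div_log_mem_Ioc hp00 p.p00_le_q2 hq2) (p.one_le_add_log_ratio hp00 hq1 hq) hu

theorem limitMeasure_jointExceedance {γ δ : ℝ} (hγ : 0 < γ) (hδ : 0 < δ) {u : ℝ}
    (hu : -Real.log n ≤ u) :
    limitMeasure γ δ (jointExceedance n u) (jointExceedance n u) =
      ENNReal.ofReal (Real.exp (-u)) := by
  obtain ⟨h1, h2, h3⟩ := div_mem_Ioc hγ hδ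
  have h4 : 0 < 1 / (1 + γ + δ) := by positivity
  rw [limitMeasure_eq hγ hδ]
  exact intensityMeasure_moIntensity_jointExceedance h1 h2 (by linarith) hu

instance : MeasurableEq (StateSpace n) := by
  refine ⟨?_⟩
  have h : Set.diagonal (StateSpace n) = {z | z.1.1 = z.2.1} := by
    ext z; simp [Subtype.ext_iff]
  rw [h]
  exact measurableSet_eq_fun (measurable_subtype_coe.comp measurable_fst)
    (measurable_subtype_coe.comp measurable_snd)

theorem dTV_le_and_d2_le (p : BernoulliPair) (hp00 : 0 < p.p00) (hq1 : p.q1 < 1)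
    (hq2 : p.q2 < 1) (hq : p.q1 * p.q2 ≤ p.p00) {γ δ : ℝ} (hγ : 0 < γ) (hδ : 0 < δ)
    {A : Set (StateSpace n)} (hA : MeasurableSet A) {P Q : Measure (PointMeasure (StateSpace n))}
    (hP : IsPRM (meanMeasure p A) P) (hQ : IsPRM (limitMeasure γ δ A) Q) :
    dTV P Q ≤ absDiff (meanMeasure p A) (limitMeasure γ δ A) A ∧
      d2 d0 P Q ≤ steinFactor (meanMeasure p A A) (limitMeasure γ δ A A) *
        absDiff (meanMeasure p A) (limitMeasure γ δ A) A := by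
  have := isFiniteMeasure_meanMeasure p hp00 hq1 hq2 hq A
  have := isFiniteMeasure_limitMeasure hγ hδ A
  have e : absDiff (meanMeasure p A) (limitMeasure γ δ A) A =
      absDiff (meanMeasure p A) (limitMeasure γ δ A) Set.univ :=
    absDiff_intensityMeasure_apply_self _ _ _ _ hA
  have e1 : meanMeasure p A A = meanMeasure p A Set.univ := intensityMeasure_apply_self _ _ _
  have e2 : limitMeasure γ δ A A = limitMeasure γ δ A Set.univ :=
    intensityMeasure_apply_self _ _ _
  rw [hP.eq_poissonLaw, hQ.eq_poissonLaw, e, e1, e2]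
  exact ⟨dTV_poissonLaw_le _ _, d2_poissonLaw_le
    (fun z w => le_min zero_le_one (Real.sqrt_nonneg _)) (fun z w => min_le_left _ _)
    (fun z => by simp) _ _⟩

theorem absDiff_jointExceedance_le (p : BernoulliPair) (hp00 : 0 < p.p00) (hq1 : p.q1 < 1)
    (hq2 : p.q2 < 1) (hq : p.q1 * p.q2 ≤ p.p00) {γ δ : ℝ} (hγ : 0 < γ) (hδ : 0 < δ)
    (h10 : p.p10 = γ * p.p11) (h01 : p.p01 = δ * p.p11) {u : ℝ} (hu : -Real.log n ≤ u) :
    absDiff (meanMeasure p (jointExceedance n u)) (limitMeasure γ δ (jointExceedance n u))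
      (jointExceedance n u) ≤
        ENNReal.ofReal (4 * (1 + γ + δ) ^ 2 * p.p11 / (1 - (1 + γ + δ) * p.p11) ^ 3 *
          Real.exp (-u)) := by
  have hθ : 0 < 1 + γ + δ := by positivity
  have hsum := p.sum_eq_one
  have e00 : p.p00 = 1 - (1 + γ + δ) * p.p11 := by rw [h10, h01] at hsum; linarith
  have e1 : p.q1 = 1 - (1 + γ) / (1 + γ + δ) * ((1 + γ + δ) * p.p11) := by
    rw [BernoulliPair.q1, e00, h01]; field_simp; ring
  have e2 : p.q2 = 1 - (1 + δ) / (1 + γ + δ) * ((1 + γ + δ) * p.p11) := by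
    rw [BernoulliPair.q2, e00, h10]; field_simp; ring
  -- Here `x = 1 - p00`, so `q1` and `q2` take the form `1 - αx` and `1 - βx` required by
  -- `log_ratio_bounds`.
  set x := (1 + γ + δ) * p.p11 with hx
  have hx1 : x < 1 := by linarith
  have hx0 : 0 < x := by linarith [p.p00_le_q1]
  obtain ⟨hα, hβ, hαβ⟩ := div_mem_Ioc hγ hδ
  obtain ⟨a1, a2⟩ := log_ratio_bounds hx0 hx1 hα.1 hα.2
  obtain ⟨b1, b2⟩ := log_ratio_bounds hx0 hx1 hβ.1 hβ.2
  rw [← e1, ← e00] at a1 a2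
  rw [← e2, ← e00] at b1 b2
  have main := absDiff_moIntensity_le (n := n) (log_div_log_mem_Ioc hp00 p.p00_le_q1 hq1)
    (log_div_log_mem_Ioc hp00 p.p00_le_q2 hq2) (p.one_le_add_log_ratio hp00 hq1 hq) hα hβ hx0.le
    hθ hαβ a2 (by rwa [← e00]) b2 (by rwa [← e00]) hu
  rw [← meanMeasure_eq p hp00 hq1, ← limitMeasure_eq hγ hδ] at main
  refine main.trans (ENNReal.ofReal_le_ofReal ?_)
  refine mul_le_mul_of_nonneg_right ?_ (Real.exp_nonneg _)
  have hc : 0 < (1 - x) ^ 3 := pow_pos (by linarith) 3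
  rw [le_div_iff₀ hc]
  -- The bound `4x` is stronger than the claim; the extra factor `1+γ+δ ≥ 1` and the cube in the
  -- denominator are slack.
  have h1 : (1 - x) ^ 3 ≤ 1 := pow_le_one₀ (by linarith) (by linarith)
  calc 4 * x * (1 - x) ^ 3 ≤ 4 * x * 1 := by gcongr
    _ ≤ 4 * x * (1 + γ + δ) := by gcongr; linarith
    _ = 4 * (1 + γ + δ) ^ 2 * p.p11 := by rw [hx]; ring

theorem steinFactor_exp (u : ℝ) :
    steinFactor (ENNReal.ofReal (Real.exp (-u))) (ENNReal.ofReal (Real.exp (-u))) =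
      ENNReal.ofReal (min 1 (1.65 * Real.exp (u / 2))) := by
  rw [steinFactor, min_self, ENNReal.ofReal_rpow_of_pos (Real.exp_pos _), ← Real.exp_mul,
    ← ENNReal.ofReal_mul (by norm_num), ← ENNReal.ofReal_one, ← ENNReal.ofReal_min]
  congr 4
  ring

end Setting

end

theorem theoremt (n : ℕ) (hn : 1 ≤ n) (p : BernoulliPair) (hp00 : 0 < p.p00)
    (hq1 : p.q1 < 1) (hq2 : p.q2 < 1) (hq : p.q1 * p.q2 ≤ p.p00)
    (γ δ : ℝ) (hγ : 0 < γ) (hδ : 0 < δ) :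
    -- arbitrary Borel sets
    (∀ A : Set (StateSpace n), MeasurableSet A →
      ∀ P Q : Measure (PointMeasure (StateSpace n)),
        IsPRM (meanMeasure p A) P → IsPRM (limitMeasure γ δ A) Q →
        dTV P Q ≤ absDiff (meanMeasure p A) (limitMeasure γ δ A) A ∧
        d2 d0 P Q ≤ steinFactor (meanMeasure p A A) (limitMeasure γ δ A A) *
          absDiff (meanMeasure p A) (limitMeasure γ δ A) A) ∧
    -- joint threshold exceedances
    (p.p10 = γ * p.p11 → p.p01 = δ * p.p11 →
      ∀ u : ℝ, -Real.log n ≤ u → ∀ A : Set (StateSpace n), A = jointExceedance n u →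
        absDiff (meanMeasure p A) (limitMeasure γ δ A) A ≤
          ENNReal.ofReal (4 * (1 + γ + δ) ^ 2 * p.p11 / (1 - (1 + γ + δ) * p.p11) ^ 3 *
            Real.exp (-u)) ∧
        steinFactor (meanMeasure p A A) (limitMeasure γ δ A A) *
            absDiff (meanMeasure p A) (limitMeasure γ δ A) A ≤
          ENNReal.ofReal (min (Real.exp (-u)) (1.65 * Real.exp (-u / 2)) *
            (4 * (1 + γ + δ) ^ 2 * p.p11 / (1 - (1 + γ + δ) * p.p11) ^ 3)) ∧
        ∀ P Q : Measure (PointMeasure (StateSpace n)),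
          IsPRM (meanMeasure p A) P → IsPRM (limitMeasure γ δ A) Q →
          dTV P Q ≤
            ENNReal.ofReal (4 * (1 + γ + δ) ^ 2 * p.p11 / (1 - (1 + γ + δ) * p.p11) ^ 3 *
              Real.exp (-u)) ∧
          d2 d0 P Q ≤
            ENNReal.ofReal (min (Real.exp (-u)) (1.65 * Real.exp (-u / 2)) *
              (4 * (1 + γ + δ) ^ 2 * p.p11 / (1 - (1 + γ + δ) * p.p11) ^ 3))) := by
  have borel_bound : ∀ A : Set (StateSpace n), MeasurableSet A →
      ∀ P Q : Measure (PointMeasure (StateSpace n)),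
        IsPRM (meanMeasure p A) P → IsPRM (limitMeasure γ δ A) Q →
        dTV P Q ≤ absDiff (meanMeasure p A) (limitMeasure γ δ A) A ∧
        d2 d0 P Q ≤ steinFactor (meanMeasure p A A) (limitMeasure γ δ A A) *
          absDiff (meanMeasure p A) (limitMeasure γ δ A) A := fun A hA P Q hP hQ =>
    dTV_le_and_d2_le p hp00 hq1 hq2 hq hγ hδ hA hP hQ
  refine ⟨borel_bound, ?_⟩
  rintro h10 h01 u hu A rfl
  have hvar := absDiff_jointExceedance_le p hp00 hq1 hq2 hq hγ hδ h10 h01 hu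
  have hstein : steinFactor (meanMeasure p (jointExceedance n u) (jointExceedance n u))
      (limitMeasure γ δ (jointExceedance n u) (jointExceedance n u)) *
        absDiff (meanMeasure p (jointExceedance n u)) (limitMeasure γ δ (jointExceedance n u))
          (jointExceedance n u) ≤
      ENNReal.ofReal (min (Real.exp (-u)) (1.65 * Real.exp (-u / 2)) *
        (4 * (1 + γ + δ) ^ 2 * p.p11 / (1 - (1 + γ + δ) * p.p11) ^ 3)) := by
    -- Both masses equal `exp(-u)`, so the Stein factor is `min(1, 1.65 exp(u/2))`; multiplying it
    -- by `exp(-u)` gives the stated minimum.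
    rw [meanMeasure_jointExceedance p hp00 hq1 hq2 hq hu, limitMeasure_jointExceedance hγ hδ hu,
      steinFactor_exp]
    refine (mul_le_mul_right hvar _).trans_eq ?_
    have hnn : (0 : ℝ) ≤ min 1 (1.65 * Real.exp (u / 2)) := by
      have := Real.exp_pos (u / 2)
      exact le_min zero_le_one (mul_nonneg (by norm_num) this.le)
    rw [← ENNReal.ofReal_mul hnn]
    congr 1
    have hexp : Real.exp (u / 2) * Real.exp (-u) = Real.exp (-u / 2) := by
      rw [← Real.exp_add]; congr 1; ring
    have hmin : min (Real.exp (-u)) (1.65 * Real.exp (-u / 2)) =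
        min 1 (1.65 * Real.exp (u / 2)) * Real.exp (-u) := by
      rw [min_mul_of_nonneg _ _ (Real.exp_nonneg _), one_mul, mul_assoc, hexp]
    rw [hmin]
    ring
  refine ⟨hvar, hstein, fun P Q hP hQ => ?_⟩
  obtain ⟨h1, h2⟩ := borel_bound _ (measurableSet_jointExceedance n u) P Q hP hQ
  exact ⟨h1.trans hvar, h2.trans hstein⟩
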